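/- Let $\mathcal H$ be a complex Hilbert space with inner product $(\cdot,\cdot)$, let $\omega>0$, let $k>1$ be an integer, and put $\lambda_n=\pi^{2k}n^{2k}/\omega^{2k}$, $n\in\mathbb N=\{1,2,\dots\}$. Let $A$ be a (densely defined, closed) normal operator in $\mathcal H$ with $\sigma(A)=\{\lambda_n : n\in\mathbb N\}$, every $\lambda_n$ being a simple eigenvalue with unit eigenvector $e_n$. Put $P_nx=(x,e_n)e_n$ and, for $m\in\mathbb N$, $P_{(m)}=P_1+\dots+P_m$. Let $B$ be a Hilbert–Schmidt operator, with Hilbert–Schmidt norm $\|X\|_2=\big(\sum_{n,j}|(Xe_n,e_j)|^2\big)^{1/2}$. For Hilbert–Schmidt $X$ put $$JX=\sum_{n}P_nXP_n,\qquad \Gamma X=\sum_{s\ne j}\frac{P_sXP_j}{\lambda_s-\lambda_j},$$ $$J_mX=J(X-P_{(m)}XP_{(m)})+P_{(m)}XP_{(m)},\qquad \Gamma_mX=\Gamma(X-P_{(m)}XP_{(m)}).$$ Let $m\in\mathbb N$ satisfy $$\frac{\omega^{2k}\|B\|_2}{\pi^{2k}(2m+1)m^{2k-2}}<\frac14 .$$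 Then the equation $$X=B\,\Gamma_mX-(\Gamma_mX)(J_mB)-(\Gamma_mX)\,J_m(B\,\Gamma_mX)+B$$ has a unique Hilbert–Schmidt solution $X_*$ in the ball $\|X-B\|_2\le 3\|B\|_2$, and $$\sigma(A-B)=\sigma_{(m)}\cup\bigcup_{n\ge m+1}\sigma_n ,$$ where the sets $\sigma_{(m)},\sigma_{m+1},\sigma_{m+2},\dots$ are mutually disjoint, $\sigma_{(m)}$ is the spectrum of the restriction of $A-P_{(m)}X_*P_{(m)}$ to $\operatorname{Im}P_{(m)}$ and is a finite set of at most $m$ points, and, for $n\ge m+1$, $\sigma_n$ is the spectrum of the restriction of $A-P_nX_*P_n$ to $\operatorname{Im}P_n$ and is a singleton $\{\widetilde\lambda_n\}$, where $\widetilde\lambda_n$ is an eigenvalue of $A-B$ of algebraic multiplicity one. Moreover, with $$n_1=\max\Big\{m+1,\ \big(6\|B\|_2\,\omega^{2k}\pi^{-2k}\big)^{1/(2k-1)}\Big\},$$ for all integers $n\ge n_1$ $$\widetilde\lambda_n=\frac{\pi^{2k}n^{2k}}{\omega^{2k}}-(Be_n,e_n)+\eta_n,\qquad |\eta_n|\le\frac{2\omega^{2k}}{\pi^{2k}n^{2k-1}}\,\|P_nB-P_nBP_n\|_2\,\|BP_n-P_nBP_n\|_2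 .$$ -/

import Mathlib

noncomputable section

namespace DirSim

section Unbounded

variable {E : Type*} [NormedAddCommGroup E] [NormedSpace ℂ E]

/-- `R` is the bounded inverse `(T - μ)⁻¹`, defined on all of `E`. -/
def IsResolventAt (T : E →ₗ.[ℂ] E) (μ : ℂ) (R : E →L[ℂ] E) : Prop :=
  (∀ y : E, ∃ h : R y ∈ T.domain, T ⟨R y, h⟩ - μ • R y = y) ∧
    ∀ x : T.domain, R (T x - μ • (x : E)) = x

/-- The spectrum of a (possibly unbounded) operator: the complement of its resolvent set. -/
def opSpectrum (T : E →ₗ.[ℂ] E) : Set ℂ := {μ | ¬ ∃ R : E →L[ℂ] E, IsResolventAt T μ R}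

/-- `x ∈ ker (T - μ)^r`, with the natural domain of the power. -/
def IsRootVector (T : E →ₗ.[ℂ] E) (μ : ℂ) : ℕ → E → Prop
  | 0, x => x = 0
  | r + 1, x => ∃ h : x ∈ T.domain, IsRootVector T μ r (T ⟨x, h⟩ - μ • x)

/-- `μ` is an eigenvalue of `T` of algebraic multiplicity one: the root subspace
`⋃ r, ker (T - μ)^r` is a line. -/
def IsSimpleEigenvalue (T : E →ₗ.[ℂ] E) (μ : ℂ) : Prop :=
  ∃ v : E, v ≠ 0 ∧ ∀ x : E, (∃ r : ℕ, IsRootVector T μ r x) ↔ x ∈ Submodule.span ℂ {v}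

/-- The operator `T - B` with domain `D(T)`, for a bounded `B`. -/
def subBounded (T : E →ₗ.[ℂ] E) (B : E →L[ℂ] E) : E →ₗ.[ℂ] E where
  domain := T.domain
  toFun := T.toFun - (B : E →ₗ[ℂ] E).comp T.domain.subtype

/-- The restriction of `T` to the subspace `S`, with domain `{x ∈ S ∩ D(T) : T x ∈ S}`
(which is all of `S` when `S` is contained in `D(T)` and invariant). -/
def restrictTo (T : E →ₗ.[ℂ] E) (S : Submodule ℂ E) : S →ₗ.[ℂ] S where
  domain :=
    { carrier := {x | ∃ h : (x : E) ∈ T.domain, T ⟨x, h⟩ ∈ S}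
      zero_mem' := ⟨T.domain.zero_mem, by
        have h : T (0 : T.domain) ∈ S := by rw [LinearPMap.map_zero]; exact S.zero_mem
        exact h⟩
      add_mem' := by
        rintro x y ⟨hx, hx'⟩ ⟨hy, hy'⟩
        refine ⟨T.domain.add_mem hx hy, ?_⟩
        have h := S.add_mem hx' hy'
        rw [← LinearPMap.map_add] at h
        exact h
      smul_mem' := by
        rintro c x ⟨hx, hx'⟩
        refine ⟨T.domain.smul_mem c hx, ?_⟩
        have h := S.smul_mem c hx'
        rw [← LinearPMap.map_smul] at h
        exact h }
  toFun :=
    { toFun := fun x => ⟨T ⟨((x : S) : E), x.2.1⟩, x.2.2⟩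
      map_add' := fun x y =>
        Subtype.ext (T.map_add ⟨((x : S) : E), x.2.1⟩ ⟨((y : S) : E), y.2.1⟩)
      map_smul' := fun c x => Subtype.ext (T.map_smul c ⟨((x : S) : E), x.2.1⟩) }

end Unbounded

variable {H : Type*} [NormedAddCommGroup H] [InnerProductSpace ℂ H]

/-- Normal (unbounded) operator: densely defined, closed, `D(T) = D(T*)` and
`‖T x‖ = ‖T* x‖` there. -/
def IsNormalOp [CompleteSpace H] (T : H →ₗ.[ℂ] H) : Prop :=
  Dense (T.domain : Set H) ∧ T.IsClosed ∧ T.adjoint.domain = T.domain ∧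
    ∀ (x : H) (h : x ∈ T.domain) (h' : x ∈ T.adjoint.domain), ‖T ⟨x, h⟩‖ = ‖T.adjoint ⟨x, h'⟩‖

/-- The numbers `λ_n = π^{2k} n^{2k} / ω^{2k}`, `n = 1, 2, …`. -/
def lam (ω : ℝ) (k : ℕ) (n : ℕ+) : ℝ :=
  Real.pi ^ (2 * k) * (n : ℝ) ^ (2 * k) / ω ^ (2 * k)

/-- `A` is a normal operator whose spectrum is `{λ_n : n ≥ 1}`, each `λ_n` being an eigenvalue
with one-dimensional eigenspace spanned by the unit vector `e n`. -/
structure IsDirichletModel [CompleteSpace H] (A : H →ₗ.[ℂ] H) (e : ℕ+ → H) (ω : ℝ) (k : ℕ) :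
    Prop where
  normal : IsNormalOp A
  spectrum_eq : opSpectrum A = Set.range fun n : ℕ+ => (lam ω k n : ℂ)
  norm_eq_one : ∀ n, ‖e n‖ = 1
  eigen : ∀ n, ∃ h : e n ∈ A.domain, A ⟨e n, h⟩ = (lam ω k n : ℂ) • e n
  simple : ∀ (n : ℕ+) (x : A.domain), A x = (lam ω k n : ℂ) • (x : H) →
    (x : H) ∈ Submodule.span ℂ {e n}

/-- `X` is Hilbert–Schmidt, in terms of its matrix `(X e_n, e_j)` in the eigenbasis `e`. -/
def IsHS (e : ℕ+ → H) (X : H →L[ℂ] H) : Prop :=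
  Summable fun p : ℕ+ × ℕ+ => ‖inner ℂ (e p.2) (X (e p.1))‖ ^ 2

/-- The Hilbert–Schmidt norm `(∑_{n,j} |(X e_n, e_j)|²)^{1/2}`. -/
def hsNorm (e : ℕ+ → H) (X : H →L[ℂ] H) : ℝ :=
  √(∑' p : ℕ+ × ℕ+, ‖inner ℂ (e p.2) (X (e p.1))‖ ^ 2)

/-- The projection `P_n x = (x, e_n) e_n`. -/
def proj (e : ℕ+ → H) (n : ℕ+) : H →L[ℂ] H := InnerProductSpace.rankOne ℂ (e n) (e n)

/-- The projection `P_(m) = P_1 + ⋯ + P_m`. -/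
def projLE (e : ℕ+ → H) (m : ℕ+) : H →L[ℂ] H := ∑ j ∈ Finset.Icc 1 m, proj e j

/-- `J X = ∑_n P_n X P_n`. -/
def J (e : ℕ+ → H) (X : H →L[ℂ] H) : H →L[ℂ] H := ∑' n : ℕ+, proj e n ∘L X ∘L proj e n

/-- `Γ X = ∑_{s ≠ j} (λ_s - λ_j)⁻¹ P_s X P_j`. -/
def Gam (e : ℕ+ → H) (ω : ℝ) (k : ℕ) (X : H →L[ℂ] H) : H →L[ℂ] H :=
  ∑' p : ℕ+ × ℕ+, if p.1 = p.2 then 0 else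
    (((lam ω k p.1 - lam ω k p.2)⁻¹ : ℝ) : ℂ) • (proj e p.1 ∘L X ∘L proj e p.2)

/-- `J_m X = J (X - P_(m) X P_(m)) + P_(m) X P_(m)`. -/
def Jm (e : ℕ+ → H) (m : ℕ+) (X : H →L[ℂ] H) : H →L[ℂ] H :=
  J e (X - projLE e m ∘L X ∘L projLE e m) + projLE e m ∘L X ∘L projLE e m

/-- `Γ_m X = Γ (X - P_(m) X P_(m))`. -/
def Gamm (e : ℕ+ → H) (ω : ℝ) (k : ℕ) (m : ℕ+) (X : H →L[ℂ] H) : H →L[ℂ] H :=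
  Gam e ω k (X - projLE e m ∘L X ∘L projLE e m)

/-- `Φ(X) = B Γ_m X - (Γ_m X)(J_m B) - (Γ_m X) J_m(B Γ_m X) + B`. -/
def Phi (e : ℕ+ → H) (ω : ℝ) (k : ℕ) (m : ℕ+) (B X : H →L[ℂ] H) : H →L[ℂ] H :=
  B ∘L Gamm e ω k m X - Gamm e ω k m X ∘L Jm e m B
    - Gamm e ω k m X ∘L Jm e m (B ∘L Gamm e ω k m X) + B

/-- `X` is a Hilbert–Schmidt solution of `X = Φ(X)` in the ball `‖X - B‖₂ ≤ 3 ‖B‖₂`. -/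
def IsSol (e : ℕ+ → H) (ω : ℝ) (k : ℕ) (m : ℕ+) (B X : H →L[ℂ] H) : Prop :=
  IsHS e X ∧ hsNorm e (X - B) ≤ 3 * hsNorm e B ∧ X = Phi e ω k m B X

/-- The spectrum `σ_(m)` of the restriction of `A - P_(m) X P_(m)` to `Im P_(m)`. -/
def sigmaLE (A : H →ₗ.[ℂ] H) (e : ℕ+ → H) (X : H →L[ℂ] H) (m : ℕ+) : Set ℂ :=
  opSpectrum (restrictTo (subBounded A (projLE e m ∘L X ∘L projLE e m))
    (LinearMap.range (projLE e m : H →ₗ[ℂ] H)))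

/-- The spectrum `σ_n` of the restriction of `A - P_n X P_n` to `Im P_n`. -/
def sigmaN (A : H →ₗ.[ℂ] H) (e : ℕ+ → H) (X : H →L[ℂ] H) (n : ℕ+) : Set ℂ :=
  opSpectrum (restrictTo (subBounded A (proj e n ∘L X ∘L proj e n))
    (LinearMap.range (proj e n : H →ₗ[ℂ] H)))

end DirSim

end

/-! This is the method of similar operators. Write `G = Γ_m X`. The matrix entries of `G` are those
of `X` divided by `λ_i - λ_j` off the diagonal and off the leading `m`-block, and zero elsewhere, so
`G` solves the commutator equation `A G - G A = X - J_m X`. The product of `G` with a block diagonal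
operator has no block diagonal part. Applying `J_m` to the nonlinear equation therefore gives `J_m X
= J_m(B + B G)`, and the equation becomes linear in form: `X = B + B G - G J_m X` (`IsSol.eq`).
Together with the commutator equation this says `(A - B)(1 + G) = (1 + G)(A - J_m X)`. Thus `A - B`
is similar to an operator consisting of one `m × m` block and the scalars `λ_n - (X e_n, e_n)`, `n >
m`.

Everything quantitative rests on `t = gapInv * ‖B‖₂ < 1/4`, where `gapInv⁻¹` bounds from below the
gaps between eigenvalues that are not both in the `m`-block. It makes the nonlinear map a
contraction of the ball (`exists_unique_isSol`), gives `‖G‖ < 1` so that `1 + G` is invertible, and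
makes those gaps exceed `2‖J_m X‖₂`, which separates the spectral pieces
(`IsSol.two_mul_hsNorm_Jm_lt`). The similarity of the unbounded operators, with domains, is
`IsSol.mapsTo_iff`.

The hypotheses on `A` do not include completeness of the eigenvectors. That comes from the
functional calculus of the bounded inverse of `A` (`IsDirichletModel.orthogonal_eq_bot`). For the
asymptotics, `η_n = -(B G e_n, e_n)` is bounded by estimating the off-diagonal part of the `n`-th
column of `X` against that of `B` (`IsSol.norm_ent_comp_Gamm_le`). -/

noncomputable section

open InnerProductSpace

namespace DirSim

/-! ### Gaps between the eigenvalues `λ_n` and between their inverses. -/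

section Eigenvalues

lemma pow_sub_pow_ge_pow {k : ℕ} (hk : 1 ≤ k) {j n : ℕ+} (h : j < n) :
    (n : ℝ) ^ (2 * k - 1) ≤ (n : ℝ) ^ (2 * k) - (j : ℝ) ^ (2 * k) := by
  have h1 : (j : ℝ) + 1 ≤ n := by exact_mod_cast (PNat.add_one_le_iff.2 h)
  have hj : (0 : ℝ) < j := by exact_mod_cast j.pos
  obtain ⟨q, hq⟩ : ∃ q, 2 * k = q + 1 := ⟨2 * k - 1, by omega⟩
  have h2 : (j : ℝ) ^ q ≤ (n : ℝ) ^ q := pow_le_pow_left₀ hj.le (by linarith) q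
  rw [hq, Nat.add_sub_cancel, pow_succ, pow_succ]
  have h3 : (0 : ℝ) ≤ (n : ℝ) ^ q := by positivity
  nlinarith [mul_le_mul_of_nonneg_right h2 hj.le]

/-- The difference is at least `n^(2k-2) (n² - j²)`, and `n² - j² ≥ 2n - 1 ≥ 2m + 1`. -/
lemma pow_sub_pow_ge_mul {k : ℕ} (hk : 1 ≤ k) {j n m : ℕ+} (h : j < n) (hm : m < n) :
    (2 * (m : ℝ) + 1) * (m : ℝ) ^ (2 * k - 2) ≤ (n : ℝ) ^ (2 * k) - (j : ℝ) ^ (2 * k) := by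
  have h1 : (j : ℝ) + 1 ≤ n := by exact_mod_cast (PNat.add_one_le_iff.2 h)
  have h2 : (m : ℝ) + 1 ≤ n := by exact_mod_cast (PNat.add_one_le_iff.2 hm)
  have hj : (0 : ℝ) < j := by exact_mod_cast j.pos
  have hm0 : (0 : ℝ) < m := by exact_mod_cast m.pos
  obtain ⟨q, rfl⟩ : ∃ q, k = q + 1 := ⟨k - 1, by omega⟩
  have e1 : 2 * (q + 1) - 2 = 2 * q := by omega
  have e2 : 2 * (q + 1) = 2 * q + 2 := by ring
  rw [e1, e2, pow_add, pow_add]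
  have h3 : (j : ℝ) ^ (2 * q) ≤ (n : ℝ) ^ (2 * q) := pow_le_pow_left₀ hj.le (by linarith) _
  have h4 : (m : ℝ) ^ (2 * q) ≤ (n : ℝ) ^ (2 * q) := pow_le_pow_left₀ hm0.le (by linarith) _
  have h5 : (0 : ℝ) ≤ (m : ℝ) ^ (2 * q) := by positivity
  have h6 : (2 * (m : ℝ) + 1) ≤ (n : ℝ) ^ 2 - (j : ℝ) ^ 2 := by nlinarith
  have h7 := mul_le_mul_of_nonneg_right h3 (sq_nonneg (j : ℝ))
  have h8 := mul_le_mul h6 h4 h5 (by nlinarith)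
  linarith

variable {ω : ℝ} {k : ℕ}

lemma scale_pos (hω : 0 < ω) : 0 < Real.pi ^ (2 * k) / ω ^ (2 * k) := by
  have := Real.pi_pos
  positivity

lemma lam_eq (n : ℕ+) : lam ω k n = Real.pi ^ (2 * k) / ω ^ (2 * k) * (n : ℝ) ^ (2 * k) := by
  unfold lam; ring

lemma lam_pos (hω : 0 < ω) (n : ℕ+) : 0 < lam ω k n := by
  have : (0 : ℝ) < n := by exact_mod_cast n.pos
  rw [lam_eq]; exact mul_pos (scale_pos hω) (by positivity)

lemma le_abs_lam_sub (hω : 0 < ω) (hk : 1 ≤ k) {n j : ℕ+} (h : n ≠ j) :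
    Real.pi ^ (2 * k) / ω ^ (2 * k) * (n : ℝ) ^ (2 * k - 1) ≤ |lam ω k j - lam ω k n| := by
  rw [lam_eq, lam_eq, ← mul_sub, abs_mul, abs_of_pos (scale_pos hω)]
  refine mul_le_mul_of_nonneg_left ?_ (scale_pos hω).le
  rcases lt_or_gt_of_ne h with h | h
  · refine le_trans ?_ (le_abs_self _)
    refine le_trans ?_ (pow_sub_pow_ge_pow hk h)
    have : (n : ℝ) ≤ j := by exact_mod_cast h.le
    gcongr
  · rw [abs_sub_comm]
    exact (pow_sub_pow_ge_pow hk h).trans (le_abs_self _)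

lemma le_abs_lam_sub' (hω : 0 < ω) (hk : 1 ≤ k) {n j m : ℕ+} (h : n ≠ j)
    (hm : ¬ (n ≤ m ∧ j ≤ m)) :
    Real.pi ^ (2 * k) / ω ^ (2 * k) * ((2 * (m : ℝ) + 1) * (m : ℝ) ^ (2 * k - 2))
      ≤ |lam ω k n - lam ω k j| := by
  rw [lam_eq, lam_eq, ← mul_sub, abs_mul, abs_of_pos (scale_pos hω)]
  refine mul_le_mul_of_nonneg_left ?_ (scale_pos hω).le
  have hm' : m < n ∨ m < j := by
    by_contra hc
    push Not at hc
    exact hm hc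
  rcases lt_or_gt_of_ne h with h | h
  · rw [abs_sub_comm]
    exact (pow_sub_pow_ge_mul hk h (hm'.elim (fun a => a.trans h) id)).trans (le_abs_self _)
  · exact (pow_sub_pow_ge_mul hk h (hm'.elim id (fun a => a.trans h))).trans (le_abs_self _)

lemma scale_le_abs_lam_sub (hω : 0 < ω) (hk : 1 ≤ k) {n j : ℕ+} (h : n ≠ j) :
    Real.pi ^ (2 * k) / ω ^ (2 * k) ≤ |lam ω k j - lam ω k n| := by
  refine le_trans ?_ (le_abs_lam_sub hω hk h)
  have : (1 : ℝ) ≤ n := by exact_mod_cast n.2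
  exact le_mul_of_one_le_right (scale_pos hω).le (one_le_pow₀ this)

lemma lam_injective (hω : 0 < ω) (hk : 1 ≤ k) : Function.Injective (lam ω k) := by
  intro a b hab
  by_contra h
  have := scale_le_abs_lam_sub hω hk h
  rw [hab, sub_self, abs_zero] at this
  exact absurd this (not_le.2 (scale_pos hω))

lemma lam_strictMono (hω : 0 < ω) (hk : 1 ≤ k) : StrictMono (lam ω k) := by
  intro a b hab
  rw [lam_eq, lam_eq]
  have h1 : (a : ℝ) < b := by exact_mod_cast hab
  have := scale_pos (k := k) hω
  gcongr

lemma scale_mul_le_lam (hω : 0 < ω) (hk : 1 ≤ k) (n : ℕ+) :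
    Real.pi ^ (2 * k) / ω ^ (2 * k) * n ≤ lam ω k n := by
  rw [lam_eq]
  have h : (1 : ℝ) ≤ n := by exact_mod_cast n.2
  exact mul_le_mul_of_nonneg_left (le_self_pow₀ h (by omega)) (scale_pos hω).le

/-- The left side is `1/λ_n - 1/(λ_n + g)`, with `g` the minimal gap; the distance to the inverse of
a smaller eigenvalue is larger still. It serves as the radius isolating `1/λ_n` in the spectrum of
`A⁻¹`. -/
lemma le_abs_inv_lam_sub (hω : 0 < ω) (hk : 1 ≤ k) {n j : ℕ+} (h : n ≠ j) :
    Real.pi ^ (2 * k) / ω ^ (2 * k) /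
        (lam ω k n * (lam ω k n + Real.pi ^ (2 * k) / ω ^ (2 * k)))
      ≤ |(lam ω k j)⁻¹ - (lam ω k n)⁻¹| := by
  have hg := scale_pos (k := k) hω
  have hn := lam_pos (k := k) hω n
  have hj := lam_pos (k := k) hω j
  have hgap := scale_le_abs_lam_sub hω hk h
  set g := Real.pi ^ (2 * k) / ω ^ (2 * k)
  rw [inv_sub_inv hj.ne' hn.ne', abs_div, abs_of_pos (mul_pos hj hn),
    div_le_div_iff₀ (by positivity) (by positivity), abs_sub_comm]
  rcases lt_or_gt_of_ne h with h | h
  · have := lam_strictMono hω hk h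
    rw [abs_of_pos (by linarith)] at hgap ⊢
    nlinarith [mul_pos hn hn, mul_nonneg hn.le (sub_nonneg.2 hgap), mul_pos hn hj,
      mul_nonneg (mul_pos hn hn).le (sub_nonneg.2 hgap)]
  · have := lam_strictMono hω hk h
    rw [abs_of_neg (by linarith)] at hgap ⊢
    nlinarith [mul_pos hn hn, mul_nonneg hn.le (sub_nonneg.2 hgap), mul_pos hn hj,
      mul_nonneg (mul_pos hn hn).le (sub_nonneg.2 hgap), mul_pos hg hn,
      mul_nonneg (mul_pos hg hn).le (sub_nonneg.2 this.le)]

end Eigenvalues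

/-! ### Diagonalization of `A` through the functional calculus of its inverse. -/

section SpectralTheorem

variable {H : Type*} [NormedAddCommGroup H] [InnerProductSpace ℂ H] [CompleteSpace H]

/-- The bounded inverse of a normal operator is normal. -/
lemma IsNormalOp.isStarNormal_inverse {T : H →ₗ.[ℂ] H} (hT : IsNormalOp T) {R : H →L[ℂ] H}
    (hR : IsResolventAt T 0 R) : IsStarNormal R := by
  obtain ⟨hd, -, hdom, hnorm⟩ := hT
  obtain ⟨hR1, hR2⟩ := hR
  simp only [zero_smul, sub_zero] at hR1 hR2
  have hfa := LinearPMap.adjoint_isFormalAdjoint hd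
  have hRd : ∀ x, R x ∈ T.adjoint.domain := fun x => by rw [hdom]; exact (hR1 x).1
  -- `V = T* R` is isometric because `‖T* R x‖ = ‖T R x‖ = ‖x‖`. It is also onto, hence unitary, and
  -- `R* V = R` yields `R* = V* R`, so `‖R* x‖ = ‖R x‖`.
  let V₀ : H →ₗ[ℂ] H :=
    { toFun := fun x => T.adjoint ⟨R x, hRd x⟩
      map_add' := fun x y => by
        rw [← LinearPMap.map_add]; congr 1; exact Subtype.ext (R.map_add x y)
      map_smul' := fun c x => by
        rw [RingHom.id_apply, ← LinearPMap.map_smul]; congr 1; exact Subtype.ext (R.map_smul c x) }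
  have hV₀ : ∀ x, ‖V₀ x‖ = ‖x‖ := fun x => by
    obtain ⟨h, h'⟩ := hR1 x
    change ‖T.adjoint ⟨R x, hRd x⟩‖ = _
    rw [← hnorm _ h, h']
  let V : H →L[ℂ] H := V₀.mkContinuous 1 (fun x => by rw [hV₀, one_mul])
  have hV : ∀ x, ‖V x‖ = ‖x‖ := hV₀
  have hVa : ∀ x (h : R x ∈ T.adjoint.domain), V x = T.adjoint ⟨R x, h⟩ := fun x h => rfl
  have hb : ∀ u : T.adjoint.domain, R.adjoint (T.adjoint u) = u := fun u => by
    refine ext_inner_right ℂ fun y => ?_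
    obtain ⟨h, h'⟩ := hR1 y
    rw [ContinuousLinearMap.adjoint_inner_left]
    have := hfa u ⟨R y, h⟩
    rw [h'] at this
    exact this
  have hRV : ∀ x, R.adjoint (V x) = R x := fun x => hb ⟨R x, hRd x⟩
  have hc : ∀ y, ∀ x : T.domain, inner ℂ y (x : H) = inner ℂ (R.adjoint y) (T x) := fun y x => by
    rw [ContinuousLinearMap.adjoint_inner_left, hR2]
  have hc1 : ∀ y, R.adjoint y ∈ T.adjoint.domain := fun y =>
    LinearPMap.mem_adjoint_domain_of_exists _ ⟨y, hc y⟩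
  have hc2 : ∀ y, T.adjoint ⟨R.adjoint y, hc1 y⟩ = y := fun y =>
    LinearPMap.adjoint_apply_eq hd _ (hc y)
  have hVs : ∀ y, ∃ z, V z = y := fun y => by
    have h1 : R.adjoint y ∈ T.domain := hdom ▸ hc1 y
    refine ⟨T ⟨_, h1⟩, ?_⟩
    have h2 := hR2 ⟨_, h1⟩
    rw [hVa _ (hRd _)]
    conv_rhs => rw [← hc2 y]
    congr 1
    exact Subtype.ext h2
  have hVV := (ContinuousLinearMap.norm_map_iff_adjoint_comp_self V).1 hV
  have hV' : ∀ z, ‖V.adjoint z‖ = ‖z‖ := fun z => by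
    obtain ⟨w, rfl⟩ := hVs z
    have : V.adjoint (V w) = w := DFunLike.congr_fun hVV w
    rw [this, hV]
  have hadj : ∀ x, R.adjoint x = V.adjoint (R x) := fun x => by
    refine ext_inner_right ℂ fun y => ?_
    rw [ContinuousLinearMap.adjoint_inner_left, ContinuousLinearMap.adjoint_inner_left, ← hRV y,
      ContinuousLinearMap.adjoint_inner_right]
  rw [ContinuousLinearMap.isStarNormal_iff_norm_eq_adjoint]
  intro x
  rw [hadj, hV']

omit [CompleteSpace H] in
/-- A nonzero spectral value of the bounded inverse is the inverse of a spectral value. -/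
lemma inv_mem_opSpectrum_of_mem_spectrum {T : H →ₗ.[ℂ] H} {R : H →L[ℂ] H}
    (hR : IsResolventAt T 0 R) {μ : ℂ} (hμ : μ ∈ spectrum ℂ R) (h0 : μ ≠ 0) :
    μ⁻¹ ∈ opSpectrum T := by
  rintro ⟨S, hS1, hS2⟩
  apply hμ
  obtain ⟨hR1, hR2⟩ := hR
  simp only [zero_smul, sub_zero] at hR1 hR2
  have e1 : ∀ y, S y = R y + μ⁻¹ • R (S y) := fun y => by
    obtain ⟨h, h'⟩ := hS1 y
    have := hR2 ⟨S y, h⟩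
    rw [sub_eq_iff_eq_add] at h'
    rw [h', map_add, map_smul] at this
    exact this.symm
  have e2 : ∀ y, R y = S y - μ⁻¹ • S (R y) := fun y => by
    obtain ⟨h, h'⟩ := hR1 y
    have := hS2 ⟨R y, h⟩
    rw [h', map_sub, map_smul] at this
    exact this.symm
  have hu : IsUnit (R - algebraMap ℂ (H →L[ℂ] H) μ) := by
    rw [isUnit_iff_exists]
    -- Formally, with `R = T⁻¹` and `S = (T - μ⁻¹)⁻¹`, one has `R - μ = -μ (T - μ⁻¹) T⁻¹`, whose
    -- inverse is `-μ⁻¹ T S = -μ⁻¹ (1 + μ⁻¹ S)`.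
    refine ⟨(-μ⁻¹) • (1 + μ⁻¹ • S), ?_, ?_⟩
    · ext y
      simp only [mul_apply_eq_comp, sub_apply,
        smul_apply, add_apply,
        one_apply_eq_self, Algebra.algebraMap_eq_smul_one, map_add, map_smul]
      have h1 : R y - μ • y + μ⁻¹ • (R (S y) - μ • S y) = -μ • y := by
        rw [smul_sub, smul_smul, inv_mul_cancel₀ h0, one_smul]
        conv_lhs => enter [2, 2]; rw [e1 y]
        module
      rw [h1, smul_smul, neg_mul_neg, inv_mul_cancel₀ h0, one_smul]
    · ext y
      simp only [mul_apply_eq_comp, sub_apply,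
        smul_apply, add_apply,
        one_apply_eq_self, Algebra.algebraMap_eq_smul_one, map_sub, map_smul]
      have h1 : R y + μ⁻¹ • S (R y) = S y := by
        conv_lhs => enter [1]; rw [e2 y]
        module
      rw [h1, smul_comm μ, ← smul_sub, smul_add, smul_smul, mul_inv_cancel₀ h0, one_smul,
        sub_add_cancel_right, smul_neg, neg_smul, neg_neg, smul_smul, inv_mul_cancel₀ h0, one_smul]
  have := hu.neg
  rwa [neg_sub] at this

variable {A : H →ₗ.[ℂ] H} {e : ℕ+ → H} {ω : ℝ} {k : ℕ}

lemma IsDirichletModel.exists_inverse (hA : IsDirichletModel A e ω k) (hω : 0 < ω) :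
    ∃ R : H →L[ℂ] H, IsResolventAt A 0 R := by
  by_contra h
  have h0 : (0 : ℂ) ∈ opSpectrum A := h
  rw [hA.spectrum_eq] at h0
  obtain ⟨n, hn⟩ := h0
  exact (lam_pos (k := k) hω n).ne' (Complex.ofReal_eq_zero.1 hn)

lemma IsDirichletModel.spectrum_inverse_subset (hA : IsDirichletModel A e ω k)
    {R : H →L[ℂ] H} (hR : IsResolventAt A 0 R) {μ : ℂ} (hμ : μ ∈ spectrum ℂ R) :
    μ = 0 ∨ ∃ n, μ = (((lam ω k n)⁻¹ : ℝ) : ℂ) := by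
  by_cases h0 : μ = 0
  · exact Or.inl h0
  have := inv_mem_opSpectrum_of_mem_spectrum hR hμ h0
  rw [hA.spectrum_eq] at this
  obtain ⟨n, hn⟩ := this
  refine Or.inr ⟨n, ?_⟩
  rw [Complex.ofReal_inv, ← inv_inv μ, ← hn]

/-- `R` is normal with real spectrum: conjugation and the identity agree on the spectrum, so the
functional calculus identifies `R*` with `R`. -/
lemma IsDirichletModel.isSelfAdjoint_inverse (hA : IsDirichletModel A e ω k)
    {R : H →L[ℂ] H} (hR : IsResolventAt A 0 R) : IsSelfAdjoint R := by
  have hn : IsStarNormal R := hA.normal.isStarNormal_inverse hR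
  have h1 : cfc (fun z : ℂ => star z) R = star R := by
    rw [cfc_star (fun z : ℂ => z) R, cfc_id' ℂ R]
  have h2 : cfc (fun z : ℂ => star z) R = cfc (fun z : ℂ => z) R := by
    refine cfc_congr fun z hz => ?_
    rcases hA.spectrum_inverse_subset hR hz with rfl | ⟨n, rfl⟩
    · simp
    · simp only [RCLike.star_def, Complex.conj_ofReal]
  rw [h1, cfc_id' ℂ R] at h2
  exact h2

lemma IsDirichletModel.inverse_apply (hA : IsDirichletModel A e ω k) (hω : 0 < ω)
    {R : H →L[ℂ] H} (hR : IsResolventAt A 0 R) (n : ℕ+) :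
    R (e n) = (((lam ω k n)⁻¹ : ℝ) : ℂ) • e n := by
  obtain ⟨h, h'⟩ := hA.eigen n
  have := hR.2 ⟨e n, h⟩
  rw [h', zero_smul, sub_zero, map_smul] at this
  have hl : (lam ω k n : ℂ) ≠ 0 := by exact_mod_cast (lam_pos hω n).ne'
  rw [← smul_right_inj hl, this, smul_smul, Complex.ofReal_inv, mul_inv_cancel₀ hl, one_smul]

lemma IsDirichletModel.orthonormal (hA : IsDirichletModel A e ω k) (hω : 0 < ω) (hk : 1 ≤ k) :
    Orthonormal ℂ e := by
  obtain ⟨R, hR⟩ := hA.exists_inverse hω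
  have hs := hA.isSelfAdjoint_inverse hR
  refine ⟨hA.norm_eq_one, fun i j hij => ?_⟩
  have h1 : inner ℂ (R (e i)) (e j) = inner ℂ (e i) (R (e j)) := hs.isSymmetric (e i) (e j)
  rw [hA.inverse_apply hω hR, hA.inverse_apply hω hR, inner_smul_left, inner_smul_right,
    Complex.conj_ofReal] at h1
  have h2 : (((lam ω k i)⁻¹ : ℝ) : ℂ) ≠ (((lam ω k j)⁻¹ : ℝ) : ℂ) := by
    intro hc
    exact hij (lam_injective hω hk (inv_injective (by exact_mod_cast hc)))
  by_contra hne
  exact h2 (mul_right_cancel₀ hne h1)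

/-- A tent function at `c` of radius `δ`. -/
def tent (c δ : ℝ) (z : ℂ) : ℂ := ((max 0 (1 - ‖z - c‖ / δ) : ℝ) : ℂ)

lemma continuous_tent (c δ : ℝ) : Continuous (tent c δ) := by unfold tent; fun_prop

lemma tent_self (c δ : ℝ) : tent c δ c = 1 := by simp [tent]

lemma tent_eq_zero {c δ : ℝ} (hδ : 0 < δ) {z : ℂ} (h : δ ≤ ‖z - c‖) : tent c δ z = 0 := by
  have : 1 ≤ ‖z - c‖ / δ := (one_le_div hδ).2 h
  simp [tent, this]

/-- On the spectrum `χ` is the indicator of one isolated point, so `χ(R)` will be the spectral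
projection of `λ_n⁻¹`. -/
lemma IsDirichletModel.exists_isolating (hA : IsDirichletModel A e ω k) (hω : 0 < ω) (hk : 1 ≤ k)
    {R : H →L[ℂ] H} (hR : IsResolventAt A 0 R) (n : ℕ+) :
    ∃ χ : ℂ → ℂ, Continuous χ ∧ (∀ z, star (χ z) = χ z) ∧ χ (((lam ω k n)⁻¹ : ℝ) : ℂ) = 1 ∧
      ∀ z ∈ spectrum ℂ R, z ≠ (((lam ω k n)⁻¹ : ℝ) : ℂ) → χ z = 0 := by
  have hg := scale_pos (k := k) hω
  have hn := lam_pos (k := k) hω n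
  set g := Real.pi ^ (2 * k) / ω ^ (2 * k) with hgdef
  have hδ : 0 < g / (lam ω k n * (lam ω k n + g)) := by positivity
  refine ⟨tent (lam ω k n)⁻¹ (g / (lam ω k n * (lam ω k n + g))), continuous_tent _ _,
    fun z => Complex.conj_ofReal _, tent_self _ _, fun z hz hne => tent_eq_zero hδ ?_⟩
  rcases hA.spectrum_inverse_subset hR hz with rfl | ⟨j, rfl⟩
  · rw [zero_sub, norm_neg, Complex.norm_real, Real.norm_eq_abs, abs_of_pos (by positivity),
      div_le_iff₀ (by positivity)]
    field_simp
    linarith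
  · rw [← Complex.ofReal_sub, Complex.norm_real, Real.norm_eq_abs]
    refine le_abs_inv_lam_sub hω hk ?_
    rintro rfl
    exact hne rfl

/-- Each `χ_n(R)` is self-adjoint with range in the line of `e_n`, so it kills a vector `x`
orthogonal to all `e_n`. Hence `R x = f(R) x` with `f(z) = z (1 - χ_1 - ⋯ - χ_N)(z)`. On the
spectrum `|f| ≤ 1/λ_N`, which tends to zero, so `R x = 0` and `x = 0`. -/
lemma IsDirichletModel.orthogonal_eq_bot (hA : IsDirichletModel A e ω k) (hω : 0 < ω)
    (hk : 1 ≤ k) : (Submodule.span ℂ (Set.range e))ᗮ = ⊥ := by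
  obtain ⟨R, hR⟩ := hA.exists_inverse hω
  have hn : IsStarNormal R := hA.normal.isStarNormal_inverse hR
  choose χ hc hs h1 h0 using fun n => hA.exists_isolating hω hk hR n
  rw [Submodule.eq_bot_iff]
  intro x hx
  have hxe : ∀ n, inner ℂ (e n) x = 0 := fun n =>
    (Submodule.mem_orthogonal _ _).1 hx _ (Submodule.subset_span ⟨n, rfl⟩)
  have hRχ : ∀ n, R * cfc (χ n) R = (((lam ω k n)⁻¹ : ℝ) : ℂ) • cfc (χ n) R := fun n => by
    have hcn := (hc n).continuousOn (s := spectrum ℂ R)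
    conv_lhs => enter [1]; rw [← cfc_id' ℂ R]
    rw [← cfc_mul (fun z => z) (χ n) R, ← cfc_const_mul _ (χ n) R]
    refine cfc_congr fun z hz => ?_
    by_cases hz' : z = (((lam ω k n)⁻¹ : ℝ) : ℂ)
    · rw [hz']
    · simp only [h0 n z hz hz', mul_zero]
  have hspan : ∀ n y, cfc (χ n) R y ∈ Submodule.span ℂ {e n} := fun n y => by
    have h := DFunLike.congr_fun (hRχ n) y
    rw [mul_apply_eq_comp, smul_apply] at h
    obtain ⟨hm, hm'⟩ := hR.1 (cfc (χ n) R y)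
    rw [zero_smul, sub_zero] at hm'
    have hl : (((lam ω k n)⁻¹ : ℝ) : ℂ) ≠ 0 := by exact_mod_cast (inv_pos.2 (lam_pos hω n)).ne'
    have hl' : (lam ω k n : ℂ) ≠ 0 := by exact_mod_cast (lam_pos hω n).ne'
    have hs := hA.simple n ⟨R (cfc (χ n) R y), hm⟩ (by
      rw [hm']
      change _ = (lam ω k n : ℂ) • R (cfc (χ n) R y)
      rw [h, smul_smul, Complex.ofReal_inv, mul_inv_cancel₀ hl', one_smul])
    change R (cfc (χ n) R y) ∈ _ at hs
    rw [h] at hs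
    exact (Submodule.smul_mem_iff _ hl).1 hs
  have hPx : ∀ n, cfc (χ n) R x = 0 := fun n => by
    refine ext_inner_left ℂ fun y => ?_
    have hsa : star (cfc (χ n) R) = cfc (χ n) R := by
      rw [← cfc_star]; simp only [hs]
    rw [inner_zero_right, ← ContinuousLinearMap.adjoint_inner_left,
      ← ContinuousLinearMap.star_eq_adjoint, hsa]
    obtain ⟨c, hc⟩ := Submodule.mem_span_singleton.1 (hspan n y)
    rw [← hc, inner_smul_left, hxe, mul_zero]
  have hbound : ∀ N : ℕ+, ‖R x‖ ≤ (lam ω k N)⁻¹ * ‖x‖ := fun N => by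
    have hc' : ∀ n ∈ Finset.Icc 1 N, ContinuousOn (χ n) (spectrum ℂ R) :=
      fun n _ => (hc n).continuousOn
    have hcs : ContinuousOn (∑ n ∈ Finset.Icc 1 N, χ n) (spectrum ℂ R) :=
      Finset.sum_fn (Finset.Icc 1 N) χ ▸ (continuous_finsetSum _ fun n _ => hc n).continuousOn
    have hf : cfc (fun z => z * (1 - (∑ n ∈ Finset.Icc 1 N, χ n) z)) R
        = R * (1 - ∑ n ∈ Finset.Icc 1 N, cfc (χ n) R) := by
      rw [cfc_mul (fun z => z) (fun z => 1 - (∑ n ∈ Finset.Icc 1 N, χ n) z) R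
        continuousOn_id (continuousOn_const.sub hcs), cfc_id' ℂ R,
        cfc_sub (fun _ => 1) (∑ n ∈ Finset.Icc 1 N, χ n) R continuousOn_const hcs,
        cfc_const_one ℂ R, cfc_sum χ R _ hc']
    have hfx : cfc (fun z => z * (1 - (∑ n ∈ Finset.Icc 1 N, χ n) z)) R x = R x := by
      rw [hf, mul_apply_eq_comp]
      simp [hPx]
    rw [← hfx]
    refine ContinuousLinearMap.le_of_opNorm_le _ (norm_cfc_le (inv_pos.2 (lam_pos hω N)).le ?_) x
    intro z hz
    rw [Finset.sum_apply]
    rcases hA.spectrum_inverse_subset hR hz with rfl | ⟨j, rfl⟩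
    · rw [zero_mul, norm_zero]
      exact (inv_pos.2 (lam_pos hω N)).le
    have hχj : ∀ n, n ≠ j → χ n (((lam ω k j)⁻¹ : ℝ) : ℂ) = 0 := fun n hnj => by
      refine h0 n _ hz fun hc => hnj ?_
      exact (lam_injective hω hk (inv_injective (Complex.ofReal_injective hc))).symm
    by_cases hj : j ∈ Finset.Icc 1 N
    · rw [Finset.sum_eq_single_of_mem j hj fun n _ hnj => hχj n hnj, h1, sub_self, mul_zero,
        norm_zero]
      exact (inv_pos.2 (lam_pos hω N)).le
    · rw [Finset.sum_eq_zero fun n hn => hχj n (fun h => hj (h ▸ hn)), sub_zero, mul_one,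
        Complex.norm_real, Real.norm_eq_abs, abs_of_pos (inv_pos.2 (lam_pos hω j))]
      have : N ≤ j := by
        by_contra hlt
        exact hj (Finset.mem_Icc.2 ⟨one_le, (not_le.1 hlt).le⟩)
      exact inv_anti₀ (lam_pos hω N) ((lam_strictMono hω hk).monotone this)
  have hR0 : R x = 0 := by
    by_contra hne
    have hpos : 0 < ‖R x‖ := norm_pos_iff.2 hne
    have hg := scale_pos (k := k) hω
    obtain ⟨N, hN⟩ := exists_nat_gt (‖x‖ / ‖R x‖ / (Real.pi ^ (2 * k) / ω ^ (2 * k)))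
    have h2 := hbound N.succPNat
    have h3 := scale_mul_le_lam hω hk N.succPNat
    rw [inv_mul_eq_div, le_div_iff₀ (lam_pos hω _)] at h2
    rw [div_lt_iff₀ hg, div_lt_iff₀ hpos] at hN
    have h4 : ((N.succPNat : ℕ+) : ℝ) = N + 1 := by simp
    rw [h4] at h3
    nlinarith
  obtain ⟨h, h'⟩ := hR.1 x
  rw [← h', zero_smul, sub_zero, ← LinearPMap.map_zero A]
  congr 1
  exact Subtype.ext hR0

/-- The eigenvectors of a Dirichlet model form a Hilbert basis in which it is diagonal. -/
lemma IsDirichletModel.exists_hilbertBasis (hA : IsDirichletModel A e ω k) (hω : 0 < ω)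
    (hk : 1 ≤ k) : ∃ b : HilbertBasis ℕ+ ℂ H, ⇑b = e ∧ ∀ x y : H,
      (∃ h : x ∈ A.domain, A ⟨x, h⟩ = y) ↔
        ∀ i, inner ℂ (e i) y = (lam ω k i : ℂ) * inner ℂ (e i) x := by
  have hb := HilbertBasis.coe_mkOfOrthogonalEqBot (hA.orthonormal hω hk)
    (hA.orthogonal_eq_bot hω hk)
  refine ⟨_, hb, fun x y => ?_⟩
  obtain ⟨R, hR⟩ := hA.exists_inverse hω
  have hs := hA.isSelfAdjoint_inverse hR
  have hl : ∀ i, (lam ω k i : ℂ) ≠ 0 := fun i => by exact_mod_cast (lam_pos hω i).ne'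
  have hcoord : ∀ i z, inner ℂ (e i) z = (lam ω k i : ℂ) * inner ℂ (e i) (R z) := fun i z => by
    have h1 : inner ℂ (R (e i)) z = inner ℂ (e i) (R z) := hs.isSymmetric (e i) z
    rw [← h1, hA.inverse_apply hω hR, inner_smul_left, Complex.conj_ofReal, Complex.ofReal_inv,
      mul_inv_cancel_left₀ (hl i)]
  constructor
  · rintro ⟨h, rfl⟩ i
    have h2 := hR.2 ⟨x, h⟩
    rw [zero_smul, sub_zero] at h2
    rw [hcoord, h2]
  · intro h
    have hx : R y = x := by
      refine (HilbertBasis.mkOfOrthogonalEqBot (hA.orthonormal hω hk)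
        (hA.orthogonal_eq_bot hω hk)).repr.injective ?_
      ext i
      rw [HilbertBasis.repr_apply_apply, HilbertBasis.repr_apply_apply, hb]
      exact mul_left_cancel₀ (hl i) ((hcoord i y).symm.trans (h i))
    obtain ⟨h1, h2⟩ := hR.1 y
    rw [zero_smul, sub_zero] at h2
    subst hx
    exact ⟨h1, h2⟩

end SpectralTheorem

/-! ### Hilbert–Schmidt operators as square-summable matrices. -/

section HilbertSchmidt

variable {H : Type*} [NormedAddCommGroup H] [InnerProductSpace ℂ H]
variable (b : HilbertBasis ℕ+ ℂ H)

/-- The matrix entry `(X e_j, e_i)`. -/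
def ent (X : H →L[ℂ] H) (i j : ℕ+) : ℂ := inner ℂ (b i) (X (b j))

@[simp] lemma ent_add (X Y : H →L[ℂ] H) (i j : ℕ+) :
    ent b (X + Y) i j = ent b X i j + ent b Y i j := inner_add_right _ _ _

@[simp] lemma ent_sub (X Y : H →L[ℂ] H) (i j : ℕ+) :
    ent b (X - Y) i j = ent b X i j - ent b Y i j := inner_sub_right _ _ _

@[simp] lemma ent_zero (i j : ℕ+) : ent b (0 : H →L[ℂ] H) i j = 0 := inner_zero_right _

@[simp] lemma ent_smul (c : ℂ) (X : H →L[ℂ] H) (i j : ℕ+) :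
    ent b (c • X) i j = c * ent b X i j := inner_smul_right _ _ _

variable {b}

lemma ext_inner_basis {x y : H} (h : ∀ i, inner ℂ (b i) x = inner ℂ (b i) y) : x = y := by
  refine b.repr.injective ?_
  ext i
  rw [HilbertBasis.repr_apply_apply, HilbertBasis.repr_apply_apply, h]

lemma ext_basis {X Y : H →L[ℂ] H} (h : ∀ j, X (b j) = Y (b j)) : X = Y := by
  refine ContinuousLinearMap.ext_on (s := Set.range b) ?_ ?_
  · rw [Submodule.dense_iff_topologicalClosure_eq_top, b.dense_span]
  · rintro _ ⟨j, rfl⟩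
    exact h j

lemma ext_ent {X Y : H →L[ℂ] H} (h : ∀ i j, ent b X i j = ent b Y i j) : X = Y :=
  ext_basis fun j => ext_inner_basis fun i => h i j

variable (b)

lemma inner_basis (i j : ℕ+) : inner ℂ (b i) (b j) = if i = j then (1 : ℂ) else 0 :=
  orthonormal_iff_ite.1 b.orthonormal i j

lemma hasSum_norm_inner_sq (x : H) : HasSum (fun i => ‖inner ℂ (b i) x‖ ^ 2) (‖x‖ ^ 2) := by
  have h := b.hasSum_inner_mul_inner x x
  rw [inner_self_eq_norm_sq_to_K] at h
  have h2 := Complex.hasSum_re h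
  convert h2 using 1
  · ext i
    rw [← inner_conj_symm x (b i), ← Complex.normSq_eq_conj_mul_self, Complex.ofReal_re,
      Complex.normSq_eq_norm_sq]
  · norm_cast

lemma norm_le_of_inner_le {x y : H} {C : ℝ} (hC : 0 ≤ C)
    (h : ∀ i, ‖inner ℂ (b i) x‖ ≤ C * ‖inner ℂ (b i) y‖) : ‖x‖ ≤ C * ‖y‖ := by
  have h1 : ‖x‖ ^ 2 ≤ C ^ 2 * ‖y‖ ^ 2 :=
    hasSum_le (fun i => by
      rw [← mul_pow]; exact pow_le_pow_left₀ (norm_nonneg _) (h i) 2)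
      (hasSum_norm_inner_sq b x) ((hasSum_norm_inner_sq b y).mul_left (C ^ 2))
  rw [← mul_pow] at h1
  exact (sq_le_sq₀ (norm_nonneg _) (by positivity)).1 h1

lemma hsNorm_nonneg (e : ℕ+ → H) (X : H →L[ℂ] H) : 0 ≤ hsNorm e X := Real.sqrt_nonneg _

lemma hsNorm_sq (X : H →L[ℂ] H) :
    hsNorm b X ^ 2 = ∑' p : ℕ+ × ℕ+, ‖ent b X p.2 p.1‖ ^ 2 :=
  Real.sq_sqrt (tsum_nonneg fun _ => by positivity)

variable {b}

/-- Parseval in each column. In this form the effect of a bounded left factor is immediate. -/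
lemma IsHS.hasSum_col {X : H →L[ℂ] H} (h : IsHS b X) :
    HasSum (fun j => ‖X (b j)‖ ^ 2) (hsNorm b X ^ 2) := by
  rw [hsNorm_sq]
  exact HasSum.prod_fiberwise h.hasSum (fun j => hasSum_norm_inner_sq b (X (b j)))

lemma isHS_of_summable_col {X : H →L[ℂ] H} (h : Summable fun j => ‖X (b j)‖ ^ 2) :
    IsHS b X := by
  refine (summable_prod_of_nonneg fun _ => by positivity).2
    ⟨fun j => (hasSum_norm_inner_sq b (X (b j))).summable, ?_⟩
  convert h using 2 with j
  exact (hasSum_norm_inner_sq b (X (b j))).tsum_eq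

lemma IsHS.of_ent_le {X Y : H →L[ℂ] H} (hX : IsHS b X) {C : ℝ} (hC : 0 ≤ C)
    (h : ∀ i j, ‖ent b Y i j‖ ≤ C * ‖ent b X i j‖) :
    IsHS b Y ∧ hsNorm b Y ≤ C * hsNorm b X := by
  have h1 : ∀ p : ℕ+ × ℕ+, ‖ent b Y p.2 p.1‖ ^ 2 ≤ C ^ 2 * ‖ent b X p.2 p.1‖ ^ 2 := fun p => by
    rw [← mul_pow]; exact pow_le_pow_left₀ (norm_nonneg _) (h _ _) 2
  have hs : IsHS b Y :=
    Summable.of_nonneg_of_le (fun _ => by positivity) h1 (Summable.mul_left _ hX)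
  refine ⟨hs, ?_⟩
  rw [← sq_le_sq₀ (hsNorm_nonneg _ _) (mul_nonneg hC (hsNorm_nonneg _ _)), mul_pow, hsNorm_sq,
    hsNorm_sq, ← tsum_mul_left]
  exact Summable.tsum_le_tsum h1 hs (Summable.mul_left _ hX)

/-- The matrix of a Hilbert–Schmidt operator as a square-summable family. -/
def IsHS.vec {X : H →L[ℂ] H} (h : IsHS b X) : lp (fun _ : ℕ+ × ℕ+ => ℂ) 2 :=
  ⟨fun p => ent b X p.2 p.1, (memℓp_gen_iff (by norm_num)).2 (by simpa [IsHS, ent] using h)⟩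

lemma IsHS.vec_apply {X : H →L[ℂ] H} (h : IsHS b X) (p : ℕ+ × ℕ+) :
    h.vec p = ent b X p.2 p.1 := rfl

lemma IsHS.norm_vec {X : H →L[ℂ] H} (h : IsHS b X) : ‖h.vec‖ = hsNorm b X := by
  rw [← sq_eq_sq₀ (norm_nonneg _) (hsNorm_nonneg _ _), hsNorm_sq]
  have := lp.norm_rpow_eq_tsum (p := 2) (by norm_num) h.vec
  simpa [IsHS.vec_apply] using this

lemma IsHS.add {X Y : H →L[ℂ] H} (hX : IsHS b X) (hY : IsHS b Y) : IsHS b (X + Y) := by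
  have := (memℓp_gen_iff (p := 2) (by norm_num)).1 (lp.memℓp (hX.vec + hY.vec))
  simpa [IsHS, IsHS.vec_apply, ent, inner_add_right] using this

lemma IsHS.neg {X : H →L[ℂ] H} (hX : IsHS b X) : IsHS b (-X) := by
  simpa [IsHS] using hX

lemma IsHS.sub {X Y : H →L[ℂ] H} (hX : IsHS b X) (hY : IsHS b Y) : IsHS b (X - Y) := by
  rw [sub_eq_add_neg]; exact hX.add hY.neg

lemma hsNorm_neg (X : H →L[ℂ] H) : hsNorm b (-X) = hsNorm b X := by
  simp [hsNorm]

lemma hsNorm_add_le {X Y : H →L[ℂ] H} (hX : IsHS b X) (hY : IsHS b Y) :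
    hsNorm b (X + Y) ≤ hsNorm b X + hsNorm b Y := by
  rw [← hX.norm_vec, ← hY.norm_vec, ← (hX.add hY).norm_vec]
  have h : (hX.add hY).vec = hX.vec + hY.vec := by
    ext p
    exact ent_add b X Y _ _
  rw [h]
  exact norm_add_le _ _

lemma hsNorm_sub_le {X Y : H →L[ℂ] H} (hX : IsHS b X) (hY : IsHS b Y) :
    hsNorm b (X - Y) ≤ hsNorm b X + hsNorm b Y := by
  rw [sub_eq_add_neg, ← hsNorm_neg Y]; exact hsNorm_add_le hX hY.neg

lemma norm_apply_basis_le_hsNorm {X : H →L[ℂ] H} (h : IsHS b X) (j : ℕ+) :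
    ‖X (b j)‖ ≤ hsNorm b X := by
  rw [← sq_le_sq₀ (norm_nonneg _) (hsNorm_nonneg _ _)]
  exact le_hasSum h.hasSum_col j fun _ _ => by positivity

lemma norm_ent_le_norm_apply (X : H →L[ℂ] H) (i j : ℕ+) : ‖ent b X i j‖ ≤ ‖X (b j)‖ := by
  have := norm_inner_le_norm (𝕜 := ℂ) (b i) (X (b j))
  rwa [b.orthonormal.1, one_mul] at this

lemma norm_ent_le_hsNorm {X : H →L[ℂ] H} (h : IsHS b X) (i j : ℕ+) :
    ‖ent b X i j‖ ≤ hsNorm b X :=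
  (norm_ent_le_norm_apply X i j).trans (norm_apply_basis_le_hsNorm h j)

lemma IsHS.comp_left {Y : H →L[ℂ] H} (T : H →L[ℂ] H) (h : IsHS b Y) :
    IsHS b (T ∘L Y) ∧ hsNorm b (T ∘L Y) ≤ ‖T‖ * hsNorm b Y := by
  have h1 : ∀ j, ‖(T ∘L Y) (b j)‖ ^ 2 ≤ ‖T‖ ^ 2 * ‖Y (b j)‖ ^ 2 := fun j => by
    rw [← mul_pow]; exact pow_le_pow_left₀ (norm_nonneg _) (T.le_opNorm _) 2
  have hs : IsHS b (T ∘L Y) := isHS_of_summable_col <|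
    Summable.of_nonneg_of_le (fun _ => by positivity) h1 (h.hasSum_col.summable.mul_left _)
  refine ⟨hs, ?_⟩
  rw [← sq_le_sq₀ (hsNorm_nonneg _ _) (mul_nonneg (norm_nonneg _) (hsNorm_nonneg _ _)), mul_pow]
  exact hasSum_le h1 hs.hasSum_col (h.hasSum_col.mul_left _)

variable [CompleteSpace H]

lemma ent_adjoint (X : H →L[ℂ] H) (i j : ℕ+) :
    ent b X.adjoint i j = starRingEnd ℂ (ent b X j i) := by
  unfold ent
  rw [ContinuousLinearMap.adjoint_inner_right, inner_conj_symm]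

lemma norm_ent_adjoint (X : H →L[ℂ] H) (i j : ℕ+) :
    ‖ent b X.adjoint i j‖ = ‖ent b X j i‖ := by
  rw [ent_adjoint, RCLike.norm_conj]

lemma IsHS.adjoint {X : H →L[ℂ] H} (h : IsHS b X) : IsHS b X.adjoint := by
  have := (Equiv.prodComm ℕ+ ℕ+).summable_iff.2 h
  refine this.congr fun p => ?_
  exact congrArg (· ^ 2) (norm_ent_adjoint X p.2 p.1).symm

lemma hsNorm_adjoint (X : H →L[ℂ] H) : hsNorm b X.adjoint = hsNorm b X := by
  rw [← sq_eq_sq₀ (hsNorm_nonneg _ _) (hsNorm_nonneg _ _), hsNorm_sq, hsNorm_sq,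
    ← (Equiv.prodComm ℕ+ ℕ+).tsum_eq]
  exact tsum_congr fun p => congrArg (· ^ 2) (norm_ent_adjoint X p.1 p.2)

/-- The coordinates of `X x` are `(x, X* b_i)`; apply Cauchy–Schwarz to each and sum, the
Hilbert–Schmidt norm being invariant under the adjoint. -/
lemma norm_le_hsNorm {X : H →L[ℂ] H} (h : IsHS b X) : ‖X‖ ≤ hsNorm b X := by
  refine X.opNorm_le_bound (hsNorm_nonneg _ _) fun x => ?_
  rw [← sq_le_sq₀ (norm_nonneg _) (mul_nonneg (hsNorm_nonneg _ _) (norm_nonneg _)), mul_pow,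
    ← hsNorm_adjoint]
  refine hasSum_le (fun i => ?_) (hasSum_norm_inner_sq b (X x))
    (h.adjoint.hasSum_col.mul_right _)
  rw [← mul_pow, ← ContinuousLinearMap.adjoint_inner_left]
  exact pow_le_pow_left₀ (norm_nonneg _) (norm_inner_le_norm _ _) 2

lemma IsHS.comp {X Y : H →L[ℂ] H} (hX : IsHS b X) (hY : IsHS b Y) :
    IsHS b (X ∘L Y) ∧ hsNorm b (X ∘L Y) ≤ hsNorm b X * hsNorm b Y :=
  ⟨(hY.comp_left X).1, (hY.comp_left X).2.trans
    (mul_le_mul_of_nonneg_right (norm_le_hsNorm hX) (hsNorm_nonneg _ _))⟩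

omit [CompleteSpace H] in
lemma ent_rankOne (p : ℕ+ × ℕ+) (i j : ℕ+) :
    ent b (rankOne ℂ (b p.1) (b p.2)) i j = if (i, j) = p then 1 else 0 := by
  unfold ent
  rw [rankOne_apply, inner_smul_right, inner_basis, inner_basis]
  obtain ⟨p, q⟩ := p
  simp only [Prod.mk.injEq, eq_comm (a := j)]
  by_cases h1 : q = j <;> by_cases h2 : i = p <;> simp [h1, h2]

omit [CompleteSpace H] in
lemma ent_sum_rankOne (c : ℕ+ × ℕ+ → ℂ) (F : Finset (ℕ+ × ℕ+)) (i j : ℕ+) :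
    ent b (∑ p ∈ F, c p • rankOne ℂ (b p.1) (b p.2)) i j
      = if (i, j) ∈ F then c (i, j) else 0 := by
  have : ent b (∑ p ∈ F, c p • rankOne ℂ (b p.1) (b p.2)) i j
      = ∑ p ∈ F, ent b (c p • rankOne ℂ (b p.1) (b p.2)) i j := by
    unfold ent
    rw [sum_apply, inner_sum]
  rw [this]
  simp only [ent_smul, ent_rankOne, mul_ite, mul_one, mul_zero]
  rw [Finset.sum_ite_eq]

/-- The finite estimate that turns square summability of the coefficients into the Cauchy criterion
in operator norm. -/
lemma norm_sum_rankOne_sq_le (c : ℕ+ × ℕ+ → ℂ) (F : Finset (ℕ+ × ℕ+)) :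
    ‖∑ p ∈ F, c p • rankOne ℂ (b p.1) (b p.2)‖ ^ 2 ≤ ∑ p ∈ F, ‖c p‖ ^ 2 := by
  set X := ∑ p ∈ F, c p • rankOne ℂ (b p.1) (b p.2)
  have hX : HasSum (fun p : ℕ+ × ℕ+ => ‖ent b X p.1 p.2‖ ^ 2) (∑ p ∈ F, ‖c p‖ ^ 2) := by
    have h1 : ∀ p : ℕ+ × ℕ+, ‖ent b X p.1 p.2‖ ^ 2 = if p ∈ F then ‖c p‖ ^ 2 else 0 := by
      intro p
      rw [ent_sum_rankOne]
      split_ifs <;> simp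
    have h2 : HasSum (fun p : ℕ+ × ℕ+ => ‖ent b X p.1 p.2‖ ^ 2)
        (∑ p ∈ F, ‖ent b X p.1 p.2‖ ^ 2) :=
      hasSum_sum_of_ne_finset_zero fun p hp => by rw [h1, if_neg hp]
    convert h2 using 1
    exact Finset.sum_congr rfl fun p hp => by rw [h1, if_pos hp]
  have hX' : HasSum (fun p : ℕ+ × ℕ+ => ‖ent b X p.2 p.1‖ ^ 2) (∑ p ∈ F, ‖c p‖ ^ 2) :=
    (Equiv.prodComm ℕ+ ℕ+).hasSum_iff.2 hX
  rw [← hX'.tsum_eq, ← hsNorm_sq]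
  exact pow_le_pow_left₀ (norm_nonneg _) (norm_le_hsNorm hX'.summable) 2

variable (b) in
/-- A square-summable matrix defines a bounded operator, as a norm-convergent sum. -/
lemma exists_hasSum_rankOne {c : ℕ+ × ℕ+ → ℂ} (hc : Summable fun p => ‖c p‖ ^ 2) :
    ∃ X : H →L[ℂ] H, HasSum (fun p => c p • rankOne ℂ (b p.1) (b p.2)) X ∧
      ∀ i j, ent b X i j = c (i, j) := by
  have hs : Summable fun p => c p • rankOne ℂ (b p.1) (b p.2) := by
    rw [summable_iff_vanishing_norm]
    intro ε hε
    obtain ⟨s, hs⟩ := summable_iff_vanishing_norm.1 hc (ε ^ 2) (by positivity)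
    refine ⟨s, fun t ht => ?_⟩
    rw [← sq_lt_sq₀ (norm_nonneg _) hε.le]
    exact (norm_sum_rankOne_sq_le c t).trans_lt ((le_abs_self _).trans_lt (hs t ht))
  refine ⟨_, hs.hasSum, fun i j => ?_⟩
  have h1 := hs.hasSum.mapL
    ((innerSL ℂ (b i)).comp (ContinuousLinearMap.apply ℂ H (b j)))
  have h2 : ∀ p : ℕ+ × ℕ+, ((innerSL ℂ (b i)).comp (ContinuousLinearMap.apply ℂ H (b j)))
      (c p • rankOne ℂ (b p.1) (b p.2)) = if p = (i, j) then c (i, j) else 0 := by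
    intro p
    have := ent_smul b (c p) (rankOne ℂ (b p.1) (b p.2)) i j
    rw [ent_rankOne] at this
    refine this.trans ?_
    by_cases h : p = (i, j)
    · simp [h]
    · rw [if_neg h, if_neg (Ne.symm h), mul_zero]
  simp only [h2] at h1
  exact h1.unique (hasSum_ite_eq (i, j) (c (i, j)))

end HilbertSchmidt

/-! ### Matrix entries of the projections, of `J`, `Γ`, `J_m` and `Γ_m`. -/

section Entries

variable {H : Type*} [NormedAddCommGroup H] [InnerProductSpace ℂ H]
variable {b : HilbertBasis ℕ+ ℂ H}

lemma proj_apply (e : ℕ+ → H) (n : ℕ+) (x : H) : proj e n x = inner ℂ (e n) x • e n :=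
  rankOne_apply _ _ _

lemma inner_proj (n i : ℕ+) (x : H) :
    inner ℂ (b i) (proj b n x) = if i = n then inner ℂ (b i) x else 0 := by
  rw [proj_apply, inner_smul_right, inner_basis]
  split_ifs with h
  · rw [h, mul_one]
  · rw [mul_zero]

lemma proj_basis (n j : ℕ+) : proj b n (b j) = if j = n then b j else 0 := by
  rw [proj_apply, inner_basis]
  by_cases h : n = j
  · simp [h]
  · rw [if_neg h, if_neg (Ne.symm h), zero_smul]

lemma projLE_apply (e : ℕ+ → H) (m : ℕ+) (x : H) :
    projLE e m x = ∑ j ∈ Finset.Icc 1 m, proj e j x := by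
  rw [projLE, sum_apply]

lemma inner_projLE (m i : ℕ+) (x : H) :
    inner ℂ (b i) (projLE b m x) = if i ≤ m then inner ℂ (b i) x else 0 := by
  rw [projLE_apply, inner_sum]
  simp only [inner_proj]
  rw [Finset.sum_ite_eq]
  simp [Finset.mem_Icc]

lemma projLE_basis (m j : ℕ+) : projLE b m (b j) = if j ≤ m then b j else 0 := by
  rw [projLE_apply]
  simp only [proj_basis]
  rw [Finset.sum_ite_eq]
  simp [Finset.mem_Icc]

lemma ent_proj_comp (X : H →L[ℂ] H) (n i j : ℕ+) :
    ent b (proj b n ∘L X) i j = if i = n then ent b X i j else 0 := inner_proj _ _ _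

lemma ent_comp_proj (X : H →L[ℂ] H) (n i j : ℕ+) :
    ent b (X ∘L proj b n) i j = if j = n then ent b X i j else 0 := by
  unfold ent
  rw [ContinuousLinearMap.comp_apply, proj_basis]
  split_ifs <;> simp

lemma ent_projLE_comp (X : H →L[ℂ] H) (m i j : ℕ+) :
    ent b (projLE b m ∘L X) i j = if i ≤ m then ent b X i j else 0 := inner_projLE _ _ _

lemma ent_comp_projLE (X : H →L[ℂ] H) (m i j : ℕ+) :
    ent b (X ∘L projLE b m) i j = if j ≤ m then ent b X i j else 0 := by
  unfold ent
  rw [ContinuousLinearMap.comp_apply, projLE_basis]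
  split_ifs <;> simp

lemma proj_comp_comp_proj (X : H →L[ℂ] H) (p q : ℕ+) :
    proj b p ∘L X ∘L proj b q = ent b X p q • rankOne ℂ (b p) (b q) := by
  ext x
  simp only [ContinuousLinearMap.comp_apply, smul_apply, proj_apply, rankOne_apply, map_smul,
smul_smul]
  rw [mul_comm]
  rfl

variable [CompleteSpace H]

/-- `J` is a `tsum` in operator norm, which would default to zero without summability. The
Hilbert–Schmidt hypothesis guarantees convergence, by `exists_hasSum_rankOne` applied to the
diagonal coefficients. -/
lemma ent_J {X : H →L[ℂ] H} (hX : IsHS b X) (i j : ℕ+) :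
    ent b (J b X) i j = if i = j then ent b X i j else 0 := by
  have hX' : Summable fun p : ℕ+ × ℕ+ => ‖ent b X p.1 p.2‖ ^ 2 :=
    (Equiv.prodComm ℕ+ ℕ+).summable_iff.2 hX
  have hc : Summable fun p : ℕ+ × ℕ+ => ‖if p.1 = p.2 then ent b X p.1 p.2 else 0‖ ^ 2 :=
    hX'.of_nonneg_of_le (fun _ => by positivity) fun p => by split_ifs <;> simp
  obtain ⟨Y, hY, hY'⟩ := exists_hasSum_rankOne b hc
  have hinj : Function.Injective fun n : ℕ+ => (n, n) := fun a c h => (Prod.mk.inj h).1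
  have hs := (hinj.hasSum_iff (f := fun p : ℕ+ × ℕ+ =>
      (if p.1 = p.2 then ent b X p.1 p.2 else 0) • rankOne ℂ (b p.1) (b p.2)) (by
    rintro ⟨p, q⟩ hpq
    have : p ≠ q := by rintro rfl; exact hpq ⟨p, rfl⟩
    simp [this])).2 hY
  have : J b X = Y := by
    rw [← hs.tsum_eq]
    exact tsum_congr fun n => by simp [proj_comp_comp_proj]
  rw [this, hY']

variable {ω : ℝ} {k : ℕ} (hω : 0 < ω) (hk : 1 ≤ k)

include hω hk in
-- Here too convergence of the `tsum` has to be secured: the gaps are bounded below, so the divided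
-- coefficients remain square summable.
lemma ent_Gam {X : H →L[ℂ] H} (hX : IsHS b X) (i j : ℕ+) :
    ent b (Gam b ω k X) i j = if i = j then 0 else
      (((lam ω k i - lam ω k j)⁻¹ : ℝ) : ℂ) * ent b X i j := by
  have hX' : Summable fun p : ℕ+ × ℕ+ => ‖ent b X p.1 p.2‖ ^ 2 :=
    (Equiv.prodComm ℕ+ ℕ+).summable_iff.2 hX
  have hg := scale_pos (k := k) hω
  have hc : Summable fun p : ℕ+ × ℕ+ => ‖if p.1 = p.2 then 0 else
      (((lam ω k p.1 - lam ω k p.2)⁻¹ : ℝ) : ℂ) * ent b X p.1 p.2‖ ^ 2 := by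
    refine Summable.of_nonneg_of_le (fun _ => by positivity) (fun p => ?_)
      (hX'.mul_left (((Real.pi ^ (2 * k) / ω ^ (2 * k))⁻¹) ^ 2))
    split_ifs with h
    · rw [norm_zero, zero_pow two_ne_zero]; positivity
    · rw [← mul_pow, norm_mul, Complex.norm_real, Real.norm_eq_abs, abs_inv]
      have h1 := scale_le_abs_lam_sub hω hk (Ne.symm h)
      gcongr
  obtain ⟨Y, hY, hY'⟩ := exists_hasSum_rankOne b hc
  have : Gam b ω k X = Y := by
    rw [← hY.tsum_eq]
    refine tsum_congr fun p => ?_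
    by_cases h : p.1 = p.2
    · simp [h]
    · rw [if_neg h, if_neg h, proj_comp_comp_proj, smul_smul]
  rw [this, hY']

omit [CompleteSpace H] in
lemma ent_cut (X : H →L[ℂ] H) (m i j : ℕ+) :
    ent b (projLE b m ∘L X ∘L projLE b m) i j = if i ≤ m ∧ j ≤ m then ent b X i j else 0 := by
  rw [ent_projLE_comp, ent_comp_projLE]
  by_cases h1 : i ≤ m <;> by_cases h2 : j ≤ m <;> simp [h1, h2]

omit [CompleteSpace H] in
lemma IsHS.cut {X : H →L[ℂ] H} (hX : IsHS b X) (m : ℕ+) :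
    IsHS b (projLE b m ∘L X ∘L projLE b m) := by
  refine (hX.of_ent_le zero_le_one fun i j => ?_).1
  rw [ent_cut, one_mul]
  split_ifs <;> simp

lemma ent_Jm {X : H →L[ℂ] H} (hX : IsHS b X) (m i j : ℕ+) :
    ent b (Jm b m X) i j = if i = j ∨ (i ≤ m ∧ j ≤ m) then ent b X i j else 0 := by
  rw [Jm, ent_add, ent_J (hX.sub (hX.cut m)), ent_sub, ent_cut]
  by_cases h1 : i = j <;> by_cases h2 : i ≤ m ∧ j ≤ m <;> simp [h1, h2]

include hω hk in
-- The index set on which this vanishes is exactly the one kept by `J_m`; this complementarity is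
-- the commutator equation `A G - G A = X - J_m X` read entrywise.
lemma ent_Gamm {X : H →L[ℂ] H} (hX : IsHS b X) (m i j : ℕ+) :
    ent b (Gamm b ω k m X) i j = if i = j ∨ (i ≤ m ∧ j ≤ m) then 0 else
      (((lam ω k i - lam ω k j)⁻¹ : ℝ) : ℂ) * ent b X i j := by
  rw [Gamm, ent_Gam hω hk (hX.sub (hX.cut m)), ent_sub, ent_cut]
  by_cases h1 : i = j <;> by_cases h2 : i ≤ m ∧ j ≤ m <;> simp [h1, h2]

lemma IsHS.jm {X : H →L[ℂ] H} (hX : IsHS b X) (m : ℕ+) :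
    IsHS b (Jm b m X) ∧ hsNorm b (Jm b m X) ≤ hsNorm b X := by
  have := hX.of_ent_le (Y := Jm b m X) zero_le_one fun i j => by
    rw [ent_Jm hX, one_mul]
    split_ifs <;> simp
  rwa [one_mul] at this

/-- The reciprocal of the lower bound for the gaps `|λ_s - λ_j|` outside the `m`-block. -/
def gapInv (ω : ℝ) (k : ℕ) (m : ℕ+) : ℝ :=
  (Real.pi ^ (2 * k) / ω ^ (2 * k) * ((2 * (m : ℝ) + 1) * (m : ℝ) ^ (2 * k - 2)))⁻¹

omit hk in
include hω in
lemma gapInv_pos (m : ℕ+) : 0 < gapInv ω k m := by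
  have := scale_pos (k := k) hω
  have h : (0 : ℝ) < m := by exact_mod_cast m.pos
  unfold gapInv
  positivity

include hω hk in
lemma IsHS.gamm {X : H →L[ℂ] H} (hX : IsHS b X) (m : ℕ+) :
    IsHS b (Gamm b ω k m X) ∧ hsNorm b (Gamm b ω k m X) ≤ gapInv ω k m * hsNorm b X := by
  refine hX.of_ent_le (gapInv_pos hω m).le fun i j => ?_
  rw [ent_Gamm hω hk hX]
  split_ifs with h
  · rw [norm_zero]
    exact mul_nonneg (gapInv_pos hω m).le (norm_nonneg _)
  · push Not at h
    rw [norm_mul, Complex.norm_real, Real.norm_eq_abs, abs_inv]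
    refine mul_le_mul_of_nonneg_right ?_ (norm_nonneg _)
    refine inv_anti₀ (inv_pos.1 (gapInv_pos hω m)) (le_abs_lam_sub' hω hk h.1 fun hc => ?_)
    exact absurd hc.2 (not_le.2 (h.2 hc.1))

end Entries

/-! ### The contraction argument for the nonlinear equation. -/

section FixedPoint

variable {H : Type*} [NormedAddCommGroup H] [InnerProductSpace ℂ H] [CompleteSpace H]
variable {b : HilbertBasis ℕ+ ℂ H} {ω : ℝ} {k : ℕ} (hω : 0 < ω) (hk : 1 ≤ k)

lemma Jm_sub {X Y : H →L[ℂ] H} (hX : IsHS b X) (hY : IsHS b Y) (m : ℕ+) :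
    Jm b m (X - Y) = Jm b m X - Jm b m Y := by
  refine ext_ent (b := b) fun i j => ?_
  rw [ent_sub, ent_Jm hX, ent_Jm hY, ent_Jm (hX.sub hY)]
  split_ifs <;> simp

include hω hk

lemma Gamm_sub {X Y : H →L[ℂ] H} (hX : IsHS b X) (hY : IsHS b Y) (m : ℕ+) :
    Gamm b ω k m (X - Y) = Gamm b ω k m X - Gamm b ω k m Y := by
  refine ext_ent (b := b) fun i j => ?_
  rw [ent_sub, ent_Gamm hω hk hX, ent_Gamm hω hk hY, ent_Gamm hω hk (hX.sub hY)]
  split_ifs <;> simp [mul_sub]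

lemma IsHS.phi {B X : H →L[ℂ] H} (hB : IsHS b B) (hX : IsHS b X) (m : ℕ+) :
    IsHS b (Phi b ω k m B X) := by
  have hG := (hX.gamm hω hk m).1
  have hBG := (hB.comp hG).1
  exact ((hBG.sub (hG.comp (hB.jm m).1).1).sub (hG.comp (hBG.jm m).1).1).add hB

lemma hsNorm_phi_sub_le {B X : H →L[ℂ] H} (hB : IsHS b B) (hX : IsHS b X) (m : ℕ+) :
    hsNorm b (Phi b ω k m B X - B) ≤
      2 * (gapInv ω k m * hsNorm b B) * hsNorm b X
        + gapInv ω k m ^ 2 * hsNorm b B * hsNorm b X ^ 2 := by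
  have hG := hX.gamm hω hk m
  have hBG := hB.comp hG.1
  have hJ := hB.jm m
  have hGJ := hG.1.comp hJ.1
  have hJ2 := hBG.1.jm m
  have hGJ2 := hG.1.comp hJ2.1
  have hg := (gapInv_pos (k := k) hω m).le
  have h1 := (hsNorm_sub_le (hBG.1.sub hGJ.1) hGJ2.1).trans
    (add_le_add_left (hsNorm_sub_le hBG.1 hGJ.1) _)
  rw [Phi, add_sub_cancel_right]
  refine h1.trans ?_
  have n1 := hsNorm_nonneg b B
  have n2 := hsNorm_nonneg b X
  have n3 := hsNorm_nonneg b (Gamm b ω k m X)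
  have a1 : hsNorm b (B ∘L Gamm b ω k m X) ≤ hsNorm b B * (gapInv ω k m * hsNorm b X) :=
    hBG.2.trans (mul_le_mul_of_nonneg_left hG.2 n1)
  have a2 : hsNorm b (Gamm b ω k m X ∘L Jm b m B) ≤ (gapInv ω k m * hsNorm b X) * hsNorm b B :=
    hGJ.2.trans (mul_le_mul hG.2 hJ.2 (hsNorm_nonneg _ _) (by positivity))
  have a3 : hsNorm b (Gamm b ω k m X ∘L Jm b m (B ∘L Gamm b ω k m X)) ≤
      (gapInv ω k m * hsNorm b X) * (hsNorm b B * (gapInv ω k m * hsNorm b X)) :=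
    hGJ2.2.trans (mul_le_mul hG.2 (hJ2.2.trans a1) (hsNorm_nonneg _ _) (by positivity))
  linarith

lemma hsNorm_phi_sub_phi_le {B X Y : H →L[ℂ] H} (hB : IsHS b B) (hX : IsHS b X) (hY : IsHS b Y)
    (m : ℕ+) :
    hsNorm b (Phi b ω k m B X - Phi b ω k m B Y) ≤
      (2 * (gapInv ω k m * hsNorm b B)
        + gapInv ω k m ^ 2 * hsNorm b B * (hsNorm b X + hsNorm b Y)) * hsNorm b (X - Y) := by
  have hXY := hX.sub hY
  have hG := hXY.gamm hω hk m
  have hGX := hX.gamm hω hk m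
  have hGY := hY.gamm hω hk m
  have hJ := hB.jm m
  have hBG := hB.comp hG.1
  have hBGX := hB.comp hGX.1
  have hBGY := hB.comp hGY.1
  have hJX := hBGX.1.jm m
  have hJG := hBG.1.jm m
  have t1 := hG.1.comp hJ.1
  have t2 := hG.1.comp hJX.1
  have t3 := hGY.1.comp hJG.1
  have e1 : Gamm b ω k m X = Gamm b ω k m Y + Gamm b ω k m (X - Y) := by
    rw [Gamm_sub hω hk hX hY]; abel
  have e2 : Jm b m (B ∘L Gamm b ω k m X)
      = Jm b m (B ∘L Gamm b ω k m Y) + Jm b m (B ∘L Gamm b ω k m (X - Y)) := by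
    rw [Gamm_sub hω hk hX hY, ContinuousLinearMap.comp_sub, Jm_sub hBGX.1 hBGY.1]; abel
  -- The term quadratic in `X` is split so that each summand contains the difference `X - Y` once.
  have key : Phi b ω k m B X - Phi b ω k m B Y =
      B ∘L Gamm b ω k m (X - Y) - Gamm b ω k m (X - Y) ∘L Jm b m B
        - (Gamm b ω k m (X - Y) ∘L Jm b m (B ∘L Gamm b ω k m X)
          + Gamm b ω k m Y ∘L Jm b m (B ∘L Gamm b ω k m (X - Y))) := by
    have e3 : Jm b m (B ∘L Gamm b ω k m (X - Y)) =
      Jm b m (B ∘L Gamm b ω k m X) - Jm b m (B ∘L Gamm b ω k m Y) := by rw [e2]; abel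
    rw [Phi, Phi, e3, Gamm_sub hω hk hX hY]
    simp only [ContinuousLinearMap.comp_sub, ContinuousLinearMap.sub_comp]
    abel
  rw [key]
  have hg := (gapInv_pos (k := k) hω m).le
  have n1 := hsNorm_nonneg b B
  have n2 := hsNorm_nonneg b X
  have n4 := hsNorm_nonneg b Y
  have n5 := hsNorm_nonneg b (X - Y)
  refine (hsNorm_sub_le (hBG.1.sub t1.1) (t2.1.add t3.1)).trans ((add_le_add
    (hsNorm_sub_le hBG.1 t1.1) (hsNorm_add_le t2.1 t3.1)).trans ?_)
  have a1 := hBG.2.trans (mul_le_mul_of_nonneg_left hG.2 n1)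
  have a1' := hBGX.2.trans (mul_le_mul_of_nonneg_left hGX.2 n1)
  have a2 := t1.2.trans (mul_le_mul hG.2 hJ.2 (hsNorm_nonneg _ _) (by positivity))
  have a3 := t2.2.trans (mul_le_mul hG.2 (hJX.2.trans a1') (hsNorm_nonneg _ _) (by positivity))
  have a4 := t3.2.trans (mul_le_mul hGY.2 (hJG.2.trans a1) (hsNorm_nonneg _ _) (by positivity))
  linarith

/-- Existence and uniqueness of the solution in the ball. -/
lemma exists_unique_isSol {B : H →L[ℂ] H} (hB : IsHS b B) {m : ℕ+}
    (hm : gapInv ω k m * hsNorm b B < 1 / 4) :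
    ∃ X, IsSol b ω k m B X ∧ ∀ Y, IsSol b ω k m B Y → Y = X := by
  have hg := (gapInv_pos (k := k) hω m).le
  have n1 := hsNorm_nonneg b B
  have hball : ∀ X, IsHS b X → hsNorm b (X - B) ≤ 3 * hsNorm b B →
      hsNorm b X ≤ 4 * hsNorm b B := fun X hX h => by
    have := hsNorm_add_le (hX.sub hB) hB
    rw [sub_add_cancel] at this
    linarith
  set t := gapInv ω k m * hsNorm b B with ht
  have ht0 : 0 ≤ t := by positivity
  have hmaps : ∀ X, IsHS b X → hsNorm b (X - B) ≤ 3 * hsNorm b B →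
      hsNorm b (Phi b ω k m B X - B) ≤ 3 * hsNorm b B := fun X hX h => by
    refine (hsNorm_phi_sub_le hω hk hB hX m).trans ?_
    have h4 := hball X hX h
    have n2 := hsNorm_nonneg b X
    calc 2 * t * hsNorm b X + gapInv ω k m ^ 2 * hsNorm b B * hsNorm b X ^ 2
        ≤ 2 * t * (4 * hsNorm b B) + gapInv ω k m ^ 2 * hsNorm b B * (4 * hsNorm b B) ^ 2 := by
          gcongr
      _ = (8 * t + 16 * t ^ 2) * hsNorm b B := by rw [ht]; ring
      _ ≤ 3 * hsNorm b B := by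
          -- For `t ≤ 1/4` one has `8t + 16t² ≤ 3`; this is where the radius `3‖B‖₂` comes from.
          refine mul_le_mul_of_nonneg_right ?_ n1
          nlinarith
  -- The Lipschitz constant on the ball, where both norms are at most `4‖B‖₂`; `q < 1` exactly when
  -- `t < 1/4`, for `t ≥ 0`.
  let q : ℝ := 2 * t + 8 * t ^ 2
  have hq0 : 0 ≤ q := by positivity
  have hq1 : q < 1 := by simp only [q]; nlinarith
  have hlip : ∀ X Y, IsHS b X → hsNorm b (X - B) ≤ 3 * hsNorm b B → IsHS b Y →
      hsNorm b (Y - B) ≤ 3 * hsNorm b B →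
      hsNorm b (Phi b ω k m B X - Phi b ω k m B Y) ≤ q * hsNorm b (X - Y) :=
    fun X Y hX hX' hY hY' => by
    refine (hsNorm_phi_sub_phi_le hω hk hB hX hY m).trans ?_
    refine mul_le_mul_of_nonneg_right ?_ (hsNorm_nonneg _ _)
    have := add_le_add (hball X hX hX') (hball Y hY hY')
    calc 2 * t + gapInv ω k m ^ 2 * hsNorm b B * (hsNorm b X + hsNorm b Y)
        ≤ 2 * t + gapInv ω k m ^ 2 * hsNorm b B * (4 * hsNorm b B + 4 * hsNorm b B) := by
          gcongr
      _ = q := by simp only [q, ht]; ring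
  -- Completeness is borrowed from `ℓ²`: Hilbert–Schmidt operators and square-summable matrices
  -- correspond isometrically, and the fixed point is found among the matrices.
  let V := lp (fun _ : ℕ+ × ℕ+ => ℂ) 2
  have hop : ∀ c : V, ∃ X : H →L[ℂ] H, IsHS b X ∧ ∀ i j, ent b X i j = c (j, i) := fun c => by
    have h1 : Summable fun p : ℕ+ × ℕ+ => ‖c p‖ ^ 2 := by
      simpa using (memℓp_gen_iff (p := 2) (by norm_num)).1 (lp.memℓp c)
    obtain ⟨X, -, hX⟩ := exists_hasSum_rankOne b (c := fun p => c (p.2, p.1))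
      ((Equiv.prodComm ℕ+ ℕ+).summable_iff.2 h1)
    refine ⟨X, ?_, hX⟩
    exact h1.congr fun p => congrArg (fun z => ‖z‖ ^ 2) (hX p.2 p.1).symm
  choose op hopHS hop using hop
  have hvec : ∀ c : V, (hopHS c).vec = c := fun c => by
    ext p
    exact hop c p.2 p.1
  have hopvec : ∀ X (hX : IsHS b X), op hX.vec = X := fun X hX => ext_ent (b := b) fun i j => hop _ i j
  have hdist : ∀ X Y (hX : IsHS b X) (hY : IsHS b Y),
      dist hX.vec hY.vec = hsNorm b (X - Y) := fun X Y hX hY => by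
    rw [dist_eq_norm, ← (hX.sub hY).norm_vec]
    congr 1
    ext p
    exact (ent_sub b X Y _ _).symm
  let Ψ : V → V := fun c => (hB.phi hω hk (hopHS c) m).vec
  let s : Set V := Metric.closedBall hB.vec (3 * hsNorm b B)
  have hmem : ∀ c, c ∈ s ↔ hsNorm b (op c - B) ≤ 3 * hsNorm b B := fun c => by
    rw [← hdist _ _ (hopHS c) hB, hvec]; rfl
  have hms : Set.MapsTo Ψ s s := fun c hc => by
    rw [hmem] at hc ⊢
    rw [hopvec]
    exact hmaps _ (hopHS c) hc
  have hcontr : ContractingWith ⟨q, hq0⟩ (hms.restrict Ψ s s) := by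
    refine ⟨hq1, LipschitzWith.of_dist_le_mul fun x y => ?_⟩
    change dist (Ψ x) (Ψ y) ≤ q * dist (x : V) (y : V)
    rw [hdist, ← hvec x, ← hvec y, hdist, hopvec, hopvec]
    exact hlip _ _ (hopHS _) ((hmem _).1 x.2) (hopHS _) ((hmem _).1 y.2)
  have hBs : hB.vec ∈ s := Metric.mem_closedBall_self (by positivity)
  obtain ⟨c, hcs, hfix, -⟩ := hcontr.exists_fixedPoint' Metric.isClosed_closedBall.isComplete hms
    hBs (edist_ne_top _ _)
  have hsol : IsSol b ω k m B (op c) := by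
    refine ⟨hopHS c, (hmem c).1 hcs, ?_⟩
    conv_lhs => rw [← hfix]
    exact hopvec _ _
  refine ⟨op c, hsol, fun Y hY => ?_⟩
  have h1 := hlip Y (op c) hY.1 hY.2.1 hsol.1 hsol.2.1
  rw [← hY.2.2, ← hsol.2.2] at h1
  have h0 : hsNorm b (Y - op c) = 0 := by
    have := hsNorm_nonneg b (Y - op c)
    nlinarith
  rw [← sub_eq_zero, ← norm_le_zero_iff, ← h0]
  exact norm_le_hsNorm (hY.1.sub hsol.1)

end FixedPoint

/-! ### Unbounded operators through their graphs: similarity, reducing projections, finite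
dimension. -/

section Graph

variable {E : Type*} [NormedAddCommGroup E] [NormedSpace ℂ E]

/-- `x` lies in the domain of `T` and `T x = y`. -/
def MapsTo (T : E →ₗ.[ℂ] E) (x y : E) : Prop := ∃ h : x ∈ T.domain, T ⟨x, h⟩ = y

lemma MapsTo.unique {T : E →ₗ.[ℂ] E} {x y z : E} (h : MapsTo T x y) (h' : MapsTo T x z) :
    y = z := by
  obtain ⟨a, rfl⟩ := h
  obtain ⟨c, rfl⟩ := h'
  rfl

lemma isResolventAt_iff {T : E →ₗ.[ℂ] E} {μ : ℂ} {R : E →L[ℂ] E} :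
    IsResolventAt T μ R ↔
      (∀ y, MapsTo T (R y) (y + μ • R y)) ∧ ∀ x y, MapsTo T x y → R (y - μ • x) = x := by
  refine and_congr (forall_congr' fun y => ?_) ⟨?_, ?_⟩
  · simp only [MapsTo, sub_eq_iff_eq_add]
  · rintro h x _ ⟨hx, rfl⟩
    exact h ⟨x, hx⟩
  · rintro h x
    exact h _ _ ⟨x.2, rfl⟩

lemma isRootVector_succ {T : E →ₗ.[ℂ] E} {μ : ℂ} {r : ℕ} {x : E} :
    IsRootVector T μ (r + 1) x ↔ ∃ y, MapsTo T x y ∧ IsRootVector T μ r (y - μ • x) := by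
  constructor
  · rintro ⟨h, h'⟩
    exact ⟨_, ⟨h, rfl⟩, h'⟩
  · rintro ⟨_, ⟨h, rfl⟩, h'⟩
    exact ⟨h, h'⟩

lemma mapsTo_subBounded {T : E →ₗ.[ℂ] E} {B : E →L[ℂ] E} {x y : E} :
    MapsTo (subBounded T B) x y ↔ MapsTo T x (y + B x) := by
  refine exists_congr fun h => ?_
  change T ⟨x, h⟩ - B x = y ↔ _
  rw [sub_eq_iff_eq_add]

lemma mapsTo_restrictTo {T : E →ₗ.[ℂ] E} {S : Submodule ℂ E} {x y : S} :
    MapsTo (restrictTo T S) x y ↔ MapsTo T x y := by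
  constructor
  · rintro ⟨h, rfl⟩
    exact ⟨h.1, rfl⟩
  · rintro ⟨h, h'⟩
    exact ⟨⟨h, by rw [h']; exact y.2⟩, Subtype.ext h'⟩

lemma opSpectrum_congr {T₁ T₂ : E →ₗ.[ℂ] E} (h : ∀ x y, MapsTo T₁ x y ↔ MapsTo T₂ x y) :
    opSpectrum T₁ = opSpectrum T₂ := by
  ext μ
  simp only [opSpectrum, isResolventAt_iff, h]

section Similarity

variable {T₁ T₂ : E →ₗ.[ℂ] E} {U V : E →L[ℂ] E}

lemma opSpectrum_subset_of_similar (hUV : ∀ x, U (V x) = x) (hVU : ∀ x, V (U x) = x)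
    (h : ∀ x y, MapsTo T₂ x y ↔ MapsTo T₁ (U x) (U y)) : opSpectrum T₂ ⊆ opSpectrum T₁ := by
  rintro μ hμ ⟨R, hR⟩
  rw [isResolventAt_iff] at hR
  refine hμ ⟨V ∘L R ∘L U, isResolventAt_iff.2 ⟨fun y => ?_, fun x y hxy => ?_⟩⟩
  · rw [h]
    simp only [ContinuousLinearMap.comp_apply, map_add, map_smul, hUV]
    exact hR.1 _
  · rw [h] at hxy
    simp only [ContinuousLinearMap.comp_apply, map_sub, map_smul]
    have := hR.2 _ _ hxy
    rw [map_sub, map_smul] at this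
    rw [← map_smul V, ← map_sub V, this, hVU]

lemma opSpectrum_eq_of_similar (hUV : ∀ x, U (V x) = x) (hVU : ∀ x, V (U x) = x)
    (h : ∀ x y, MapsTo T₂ x y ↔ MapsTo T₁ (U x) (U y)) : opSpectrum T₁ = opSpectrum T₂ := by
  refine Set.Subset.antisymm (opSpectrum_subset_of_similar hVU hUV fun x y => ?_)
    (opSpectrum_subset_of_similar hUV hVU h)
  rw [h, hUV, hUV]

lemma isRootVector_iff_of_similar (hU : Function.Injective U)
    (h : ∀ x y, MapsTo T₂ x y ↔ MapsTo T₁ (U x) (U y)) (hV : ∀ x, ∃ y, U y = x) (μ : ℂ) (r : ℕ) :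
    ∀ x, IsRootVector T₂ μ r x ↔ IsRootVector T₁ μ r (U x) := by
  induction r with
  | zero => exact fun x => (map_eq_zero_iff U hU).symm
  | succ r ih =>
    intro x
    simp only [isRootVector_succ]
    constructor
    · rintro ⟨y, h1, h2⟩
      refine ⟨U y, (h _ _).1 h1, ?_⟩
      rw [ih, map_sub, map_smul] at h2
      exact h2
    · rintro ⟨y, h1, h2⟩
      obtain ⟨y, rfl⟩ := hV y
      refine ⟨y, (h _ _).2 h1, ?_⟩
      rw [ih, map_sub, map_smul]
      exact h2

lemma IsSimpleEigenvalue.of_similar (hUV : ∀ x, U (V x) = x) (hVU : ∀ x, V (U x) = x)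
    (h : ∀ x y, MapsTo T₂ x y ↔ MapsTo T₁ (U x) (U y)) {μ : ℂ} (hμ : IsSimpleEigenvalue T₂ μ) :
    IsSimpleEigenvalue T₁ μ := by
  obtain ⟨v, hv, hv'⟩ := hμ
  have hU : Function.Injective U := Function.LeftInverse.injective hVU
  refine ⟨U v, fun h0 => hv (hU (h0.trans (map_zero U).symm)), fun x => ?_⟩
  have h1 := hv' (V x)
  simp only [isRootVector_iff_of_similar hU h (fun x => ⟨V x, hUV x⟩), hUV] at h1
  rw [h1, Submodule.mem_span_singleton, Submodule.mem_span_singleton]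
  refine exists_congr fun c => ?_
  rw [← hU.eq_iff, map_smul, hUV]

end Similarity

section Reduction

variable {T : E →ₗ.[ℂ] E} {Q : E →L[ℂ] E}

lemma apply_eq_of_mem_range (hQ : ∀ x, Q (Q x) = Q x) {x : E}
    (hx : x ∈ LinearMap.range (Q : E →ₗ[ℂ] E)) : Q x = x := by
  obtain ⟨z, rfl⟩ := hx
  exact hQ z

/-- `T` commutes with the projection `Q`, so compressing a resolvent of `T` to the range of `Q`
gives a resolvent of the restriction. -/
lemma opSpectrum_restrictTo_subset (hQ : ∀ x, Q (Q x) = Q x)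
    (hT : ∀ x y, MapsTo T x y → MapsTo T (Q x) (Q y)) :
    opSpectrum (restrictTo T (LinearMap.range (Q : E →ₗ[ℂ] E))) ⊆ opSpectrum T := by
  rintro μ hμ ⟨R, hR⟩
  rw [isResolventAt_iff] at hR
  let S := LinearMap.range (Q : E →ₗ[ℂ] E)
  let R' : S →L[ℂ] S := (Q ∘L R ∘L S.subtypeL).codRestrict S fun x => ⟨_, rfl⟩
  have hR' : ∀ x : S, (R' x : E) = Q (R x) := fun x => rfl
  refine hμ ⟨R', isResolventAt_iff.2 ⟨fun y => ?_, fun x y hxy => ?_⟩⟩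
  · rw [mapsTo_restrictTo]
    have := hT _ _ (hR.1 y)
    rw [map_add, map_smul, apply_eq_of_mem_range hQ y.2] at this
    exact this
  · rw [mapsTo_restrictTo] at hxy
    refine Subtype.ext ?_
    rw [hR']
    change Q (R ((y : E) - μ • (x : E))) = _
    rw [hR.2 _ _ hxy, apply_eq_of_mem_range hQ x.2]

/-- `Q` carries root vectors to root vectors of the restriction, on which `T - μ` is injective. -/
lemma eq_zero_of_isRootVector (hT : ∀ x y, MapsTo T x y → MapsTo T (Q x) (Q y)) {μ : ℂ}
    (hμ : μ ∉ opSpectrum (restrictTo T (LinearMap.range (Q : E →ₗ[ℂ] E)))) (r : ℕ) :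
    ∀ x, IsRootVector T μ r x → Q x = 0 := by
  obtain ⟨R, hR⟩ := not_not.1 hμ
  rw [isResolventAt_iff] at hR
  induction r with
  | zero =>
    intro x hx
    rw [show x = 0 from hx, map_zero]
  | succ r ih =>
    intro x hx
    obtain ⟨y, h1, h2⟩ := isRootVector_succ.1 hx
    have h3 := ih _ h2
    rw [map_sub, map_smul] at h3
    have h4 := hR.2 ⟨Q x, ⟨x, rfl⟩⟩ ⟨Q y, ⟨y, rfl⟩⟩ (mapsTo_restrictTo.2 (hT _ _ h1))
    have h5 : (⟨Q y, ⟨y, rfl⟩⟩ : LinearMap.range (Q : E →ₗ[ℂ] E)) - μ • ⟨Q x, ⟨x, rfl⟩⟩ = 0 :=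
      Subtype.ext h3
    rw [h5, map_zero] at h4
    exact (congrArg Subtype.val h4).symm

end Reduction

section FiniteDimensional

variable [FiniteDimensional ℂ E] {T : E →ₗ.[ℂ] E}

lemma opSpectrum_eq_setOf_eigenvalue (hT : ∀ x, ∃ y, MapsTo T x y) :
    opSpectrum T = {μ | ∃ v, v ≠ 0 ∧ MapsTo T v (μ • v)} := by
  have htop : ∀ x, x ∈ T.domain := fun x => (hT x).choose_spec.1
  let f : E →ₗ[ℂ] E :=
    { toFun := fun x => T ⟨x, htop x⟩
      map_add' := fun x y => T.map_add ⟨x, htop x⟩ ⟨y, htop y⟩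
      map_smul' := fun c x => T.map_smul c ⟨x, htop x⟩ }
  have hf : ∀ x y, MapsTo T x y ↔ f x = y := fun x y => ⟨fun ⟨_, h⟩ => h, fun h => ⟨htop x, h⟩⟩
  ext μ
  constructor
  · intro hμ
    by_contra hne
    apply hμ
    have hinj : Function.Injective (f - μ • LinearMap.id : E →ₗ[ℂ] E) := by
      rw [injective_iff_map_eq_zero]
      intro v hv
      by_contra hv0
      refine hne ⟨v, hv0, (hf _ _).2 ?_⟩
      exact sub_eq_zero.1 hv
    let g := LinearEquiv.ofInjectiveEndo _ hinj
    have hg : ∀ x, g x = f x - μ • x := fun x => rfl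
    refine ⟨LinearMap.toContinuousLinearMap (g.symm : E →ₗ[ℂ] E),
      isResolventAt_iff.2 ⟨fun y => ?_, fun x y hxy => ?_⟩⟩
    · rw [hf]
      have := g.apply_symm_apply y
      rw [hg, sub_eq_iff_eq_add] at this
      exact this
    · rw [hf] at hxy
      subst hxy
      exact g.symm_apply_apply x
  · rintro ⟨v, hv, h⟩ ⟨R, hR⟩
    have := (isResolventAt_iff.1 hR).2 _ _ h
    rw [sub_self, map_zero] at this
    exact hv this.symm

/-- In finite dimension the spectrum consists of eigenvalues, and eigenvectors for distinct
eigenvalues are linearly independent. -/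
lemma opSpectrum_finite (hT : ∀ x, ∃ y, MapsTo T x y) :
    (opSpectrum T).Finite ∧ (opSpectrum T).ncard ≤ Module.finrank ℂ E := by
  have htop : ∀ x, x ∈ T.domain := fun x => (hT x).choose_spec.1
  let f : Module.End ℂ E :=
    { toFun := fun x => T ⟨x, htop x⟩
      map_add' := fun x y => T.map_add ⟨x, htop x⟩ ⟨y, htop y⟩
      map_smul' := fun c x => T.map_smul c ⟨x, htop x⟩ }
  have h1 : ∀ μ : opSpectrum T, ∃ v : E, f.HasEigenvector μ v := fun μ => by
    obtain ⟨v, hv, _, h⟩ := (Set.ext_iff.1 (opSpectrum_eq_setOf_eigenvalue hT) μ).1 μ.2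
    exact ⟨v, Module.End.hasEigenvector_iff.2 ⟨Module.End.mem_eigenspace_iff.2 h, hv⟩⟩
  choose v hv using h1
  have hli := Module.End.eigenvectors_linearIndependent f (opSpectrum T) v hv
  have hfin : Finite (opSpectrum T) := hli.finite
  have : Fintype (opSpectrum T) := Fintype.ofFinite _
  refine ⟨Set.toFinite _, ?_⟩
  rw [← Nat.card_coe_set_eq, Nat.card_eq_fintype_card]
  exact hli.fintype_card_le_finrank

end FiniteDimensional

end Graph

/-! ### Algebra of block diagonal and off-diagonal operators. -/

section BlockAlgebra

variable {H : Type*} [NormedAddCommGroup H] [InnerProductSpace ℂ H] [CompleteSpace H]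
variable {b : HilbertBasis ℕ+ ℂ H}

omit [CompleteSpace H] in
lemma projLE_comp_projLE_apply (m : ℕ+) (x : H) : projLE b m (projLE b m x) = projLE b m x := by
  refine ext_inner_basis (b := b) fun i => ?_
  simp only [inner_projLE]
  split_ifs <;> rfl

omit [CompleteSpace H] in
lemma proj_comp_proj_apply (n : ℕ+) (x : H) : proj b n (proj b n x) = proj b n x := by
  refine ext_inner_basis (b := b) fun i => ?_
  simp only [inner_proj]
  split_ifs <;> rfl

lemma projLE_comp_Jm {X : H →L[ℂ] H} (hX : IsHS b X) (m : ℕ+) :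
    projLE b m ∘L Jm b m X = projLE b m ∘L X ∘L projLE b m := by
  refine ext_ent (b := b) fun i j => ?_
  rw [ent_projLE_comp, ent_Jm hX, ent_cut]
  by_cases h1 : i ≤ m <;> by_cases h2 : j ≤ m <;> simp only [h1, h2, if_true, if_false]
  all_goals simp
  rintro rfl
  exact absurd h1 h2

/-- With `projLE_comp_Jm` it shows that `J_m X` commutes with `P_(m)` and agrees with the
compression of `X` there. -/
lemma Jm_comp_projLE {X : H →L[ℂ] H} (hX : IsHS b X) (m : ℕ+) :
    Jm b m X ∘L projLE b m = projLE b m ∘L X ∘L projLE b m := by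
  refine ext_ent (b := b) fun i j => ?_
  rw [ent_comp_projLE, ent_Jm hX, ent_cut]
  by_cases h1 : i ≤ m <;> by_cases h2 : j ≤ m <;> simp only [h1, h2, if_true, if_false]
  all_goals simp
  rintro rfl
  exact absurd h2 h1

lemma proj_comp_Jm {X : H →L[ℂ] H} (hX : IsHS b X) {m n : ℕ+} (hn : m < n) :
    proj b n ∘L Jm b m X = ent b X n n • proj b n := by
  refine ext_ent (b := b) fun i j => ?_
  rw [ent_proj_comp, ent_Jm hX, ent_smul, proj, ent_rankOne (n, n)]
  by_cases h1 : i = n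
  · subst h1
    by_cases h2 : i = j
    · subst h2; simp
    · simp [h2, Ne.symm h2, not_le.2 hn]
  · simp [h1]

lemma Jm_comp_proj {X : H →L[ℂ] H} (hX : IsHS b X) {m n : ℕ+} (hn : m < n) :
    Jm b m X ∘L proj b n = ent b X n n • proj b n := by
  refine ext_ent (b := b) fun i j => ?_
  rw [ent_comp_proj, ent_Jm hX, ent_smul, proj, ent_rankOne (n, n)]
  by_cases h1 : j = n
  · subst h1
    by_cases h2 : i = j
    · subst h2; simp
    · simp [h2, not_le.2 hn]
  · simp [h1]

omit [CompleteSpace H] in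
lemma proj_comp_comp_proj_self (X : H →L[ℂ] H) (n : ℕ+) :
    proj b n ∘L X ∘L proj b n = ent b X n n • proj b n := proj_comp_comp_proj X n n

lemma Jm_basis {X : H →L[ℂ] H} (hX : IsHS b X) {m n : ℕ+} (hn : m < n) :
    Jm b m X (b n) = ent b X n n • b n := by
  have := DFunLike.congr_fun (Jm_comp_proj hX hn) (b n)
  simpa [proj_basis] using this

lemma inner_Jm {X : H →L[ℂ] H} (hX : IsHS b X) {m n : ℕ+} (hn : m < n) (x : H) :
    inner ℂ (b n) (Jm b m X x) = ent b X n n * inner ℂ (b n) x := by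
  have := congrArg (inner ℂ (b n)) (DFunLike.congr_fun (proj_comp_Jm hX hn) x)
  simpa [inner_proj, inner_smul_right] using this

lemma Jm_add {X Y : H →L[ℂ] H} (hX : IsHS b X) (hY : IsHS b Y) (m : ℕ+) :
    Jm b m (X + Y) = Jm b m X + Jm b m Y := by
  refine ext_ent (b := b) fun i j => ?_
  rw [ent_add, ent_Jm hX, ent_Jm hY, ent_Jm (hX.add hY)]
  split_ifs <;> simp

/-- A block off-diagonal operator times a block diagonal one has no block diagonal part. -/
lemma ent_comp_Jm_eq_zero {G Y : H →L[ℂ] H} (hY : IsHS b Y) {m : ℕ+}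
    (hG : ∀ i j, i = j ∨ (i ≤ m ∧ j ≤ m) → ent b G i j = 0) (i j : ℕ+)
    (hij : i = j ∨ (i ≤ m ∧ j ≤ m)) : ent b (G ∘L Jm b m Y) i j = 0 := by
  -- For `j > m` the vector `J_m Y b_j` is a multiple of `b_j`, and a diagonal entry of `G` appears.
  -- For `j ≤ m` it stays in `Im P_(m)`, and the compression of `G` to that subspace is zero.
  by_cases hj : m < j
  · have hij' : i = j := hij.resolve_right fun h => absurd h.2 (not_le.2 hj)
    unfold ent
    rw [ContinuousLinearMap.comp_apply, Jm_basis hY hj, map_smul, inner_smul_right]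
    exact mul_eq_zero_of_right _ (hG i j hij)
  · have hj' := not_lt.1 hj
    have hi : i ≤ m := hij.elim (fun h => h ▸ hj') fun h => h.1
    have h0 : projLE b m ∘L G ∘L projLE b m = 0 := by
      refine ext_ent (b := b) fun p q => ?_
      rw [ent_cut, ent_zero]
      split_ifs with h
      · exact hG p q (Or.inr h)
      · rfl
    have h1 : Jm b m Y (b j) = projLE b m (Jm b m Y (b j)) := by
      have h2 := DFunLike.congr_fun ((Jm_comp_projLE hY m).trans (projLE_comp_Jm hY m).symm) (b j)
      simp only [ContinuousLinearMap.comp_apply, projLE_basis, if_pos hj'] at h2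
      exact h2
    have h3 := inner_projLE (b := b) m i (G (projLE b m (Jm b m Y (b j))))
    rw [if_pos hi] at h3
    unfold ent
    rw [ContinuousLinearMap.comp_apply, h1, ← h3]
    have h4 := DFunLike.congr_fun h0 (Jm b m Y (b j))
    simp only [ContinuousLinearMap.comp_apply, zero_apply] at h4
    rw [h4, inner_zero_right]

/-- Boundedness of `d` would suffice; square summability is all that is needed for inverses of `λ_n`
plus a bounded term, and it reduces the claim to the matrix construction. -/
lemma exists_diagonal (b : HilbertBasis ℕ+ ℂ H) {d : ℕ+ → ℂ} (hd : Summable fun n => ‖d n‖ ^ 2) :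
    ∃ K : H →L[ℂ] H, ∀ i x, inner ℂ (b i) (K x) = d i * inner ℂ (b i) x := by
  have hinj : Function.Injective fun n : ℕ+ => (n, n) := fun a c h => (Prod.mk.inj h).1
  have hc : Summable fun p : ℕ+ × ℕ+ => ‖if p.1 = p.2 then d p.1 else 0‖ ^ 2 := by
    refine (hinj.summable_iff ?_).1 (hd.congr fun n => ?_)
    · rintro ⟨p, q⟩ hpq
      have : p ≠ q := by rintro rfl; exact hpq ⟨p, rfl⟩
      simp [this]
    · simp
  obtain ⟨K, -, hK⟩ := exists_hasSum_rankOne b hc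
  refine ⟨K, fun i x => ?_⟩
  have h1 : proj b i ∘L K = d i • proj b i := by
    refine ext_ent (b := b) fun p q => ?_
    rw [ent_proj_comp, hK, ent_smul, proj, ent_rankOne (i, i)]
    by_cases h : p = i
    · subst h
      by_cases h2 : p = q
      · subst h2; simp
      · simp [h2, Ne.symm h2]
    · simp [h]
  have := congrArg (inner ℂ (b i)) (DFunLike.congr_fun h1 x)
  simpa [inner_proj, inner_smul_right] using this

end BlockAlgebra

/-! ### Consequences of the nonlinear equation. -/

section Solution

variable {H : Type*} [NormedAddCommGroup H] [InnerProductSpace ℂ H] [CompleteSpace H]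
variable {b : HilbertBasis ℕ+ ℂ H} {ω : ℝ} {k : ℕ} (hω : 0 < ω) (hk : 1 ≤ k)
variable {m : ℕ+} {B X : H →L[ℂ] H}

include hω hk

lemma ent_Gamm_eq_zero (hX : IsHS b X) (i j : ℕ+) (hij : i = j ∨ (i ≤ m ∧ j ≤ m)) :
    ent b (Gamm b ω k m X) i j = 0 := by
  rw [ent_Gamm hω hk hX, if_pos hij]

/-- Both terms of the equation with left factor `Γ_m X` have a block diagonal right factor, so `J_m`
annihilates them. -/
lemma IsSol.Jm_eq (hB : IsHS b B) (h : IsSol b ω k m B X) :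
    Jm b m X = Jm b m (B + B ∘L Gamm b ω k m X) := by
  have hG := (h.1.gamm hω hk m).1
  have hBG := (hB.comp hG).1
  refine ext_ent (b := b) fun i j => ?_
  rw [ent_Jm h.1, ent_Jm (hB.add hBG)]
  split_ifs with hij
  · conv_lhs => rw [h.2.2]
    rw [Phi, ent_add, ent_sub, ent_sub, ent_add,
      ent_comp_Jm_eq_zero hB (ent_Gamm_eq_zero hω hk h.1) i j hij,
      ent_comp_Jm_eq_zero hBG (ent_Gamm_eq_zero hω hk h.1) i j hij]
    ring
  · rfl

/-- The form of the equation that, combined with the commutator equation, yields the intertwining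
relation. -/
lemma IsSol.eq (hB : IsHS b B) (h : IsSol b ω k m B X) :
    X = B + B ∘L Gamm b ω k m X - Gamm b ω k m X ∘L Jm b m X := by
  have hG := (h.1.gamm hω hk m).1
  have hBG := (hB.comp hG).1
  rw [h.Jm_eq hω hk hB, Jm_add hB hBG, ContinuousLinearMap.comp_add]
  conv_lhs => rw [h.2.2, Phi]
  abel

omit [CompleteSpace H] hω hk in
lemma IsSol.hsNorm_le (hB : IsHS b B) (h : IsSol b ω k m B X) :
    hsNorm b X ≤ 4 * hsNorm b B := by
  have := hsNorm_add_le (h.1.sub hB) hB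
  rw [sub_add_cancel] at this
  linarith [h.2.1]

/-- Sharper than `4‖B‖₂`, the bound valid for `X` itself: for `t < 1/4` the right side is at most
`2‖B‖₂`, and the separation of the spectral pieces depends on that. -/
lemma IsSol.hsNorm_Jm_le (hB : IsHS b B) (h : IsSol b ω k m B X) :
    hsNorm b (Jm b m X) ≤ hsNorm b B + 4 * (gapInv ω k m * hsNorm b B) * hsNorm b B := by
  have hG := h.1.gamm hω hk m
  have hBG := hB.comp hG.1
  have n1 := hsNorm_nonneg b B
  have hg := (gapInv_pos (k := k) hω m).le
  rw [h.Jm_eq hω hk hB]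
  refine (((hB.add hBG.1).jm m).2.trans (hsNorm_add_le hB hBG.1)).trans ?_
  have h1 : hsNorm b (B ∘L Gamm b ω k m X)
      ≤ hsNorm b B * (gapInv ω k m * (4 * hsNorm b B)) := by
    refine hBG.2.trans (mul_le_mul_of_nonneg_left (hG.2.trans ?_) n1)
    exact mul_le_mul_of_nonneg_left (h.hsNorm_le hB) hg
  linarith

lemma IsSol.norm_Gamm_lt (hB : IsHS b B) (h : IsSol b ω k m B X)
    (hm : gapInv ω k m * hsNorm b B < 1 / 4) : ‖Gamm b ω k m X‖ < 1 := by
  have hG := h.1.gamm hω hk m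
  have := mul_le_mul_of_nonneg_left (h.hsNorm_le hB) (gapInv_pos (k := k) hω m).le
  linarith [norm_le_hsNorm hG.1, hG.2]

end Solution

/-! ### The similarity and the spectrum of the block diagonal operator. -/

section Spectrum

variable {H : Type*} [NormedAddCommGroup H] [InnerProductSpace ℂ H] [CompleteSpace H]
variable {b : HilbertBasis ℕ+ ℂ H} {ω : ℝ} {k : ℕ} (hω : 0 < ω) (hk : 1 ≤ k)
variable {m : ℕ+} {A : H →ₗ.[ℂ] H} {B X : H →L[ℂ] H}
variable (hA : ∀ x y, MapsTo A x y ↔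
  ∀ i, inner ℂ (b i) y = (lam ω k i : ℂ) * inner ℂ (b i) x)

include hω hk

/-- `λ_n` grows at least linearly, so `|a_n|` is at least a multiple of `n` once `n` is large. The
finitely many other indices, where `a_n` may even vanish, do not affect summability. -/
lemma summable_norm_inv_sq {a : ℕ+ → ℂ} {C : ℝ} (h : ∀ n, ‖a n - lam ω k n‖ ≤ C) :
    Summable fun n => ‖(a n)⁻¹‖ ^ 2 := by
  have hg := scale_pos (k := k) hω
  have hs : Summable fun n : ℕ+ => (2 / (Real.pi ^ (2 * k) / ω ^ (2 * k))) ^ 2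
      * (1 / (n : ℝ) ^ 2) :=
    ((Real.summable_one_div_nat_pow.2 one_lt_two).comp_injective PNat.coe_injective).mul_left _
  obtain ⟨N, hN⟩ := exists_nat_gt (2 * C / (Real.pi ^ (2 * k) / ω ^ (2 * k)))
  rw [div_lt_iff₀ hg] at hN
  refine Summable.of_norm_bounded_eventually hs ?_
  have hfin : {n : ℕ+ | ¬ N.succPNat < n}.Finite :=
    (Set.finite_Iic N.succPNat).subset fun n hn => not_lt.1 hn
  refine Filter.mem_of_superset hfin.compl_mem_cofinite fun n hn => ?_
  have hn' : N.succPNat < n := not_not.1 hn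
  have h1 : (N : ℝ) ≤ n := by
    have h3 : (N.succPNat : ℕ) < n := hn'
    rw [Nat.succPNat_coe] at h3
    exact_mod_cast (Nat.le_succ N).trans h3.le
  have hn0 : (0 : ℝ) < n := by exact_mod_cast n.pos
  have h2 := scale_mul_le_lam hω hk n
  set g := Real.pi ^ (2 * k) / ω ^ (2 * k)
  have h4 : g * n / 2 ≤ ‖a n‖ := by
    have h5 := norm_sub_norm_le (lam ω k n : ℂ) (a n)
    rw [norm_sub_rev, Complex.norm_real, Real.norm_eq_abs, abs_of_pos (lam_pos hω n)] at h5
    have h6 := h n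
    nlinarith [mul_le_mul_of_nonneg_left h1 hg.le]
  change ‖‖(a n)⁻¹‖ ^ 2‖ ≤ _
  rw [norm_pow, norm_norm, norm_inv, ← one_div_pow, ← mul_pow, div_mul_div_comm, mul_one,
    ← inv_div]
  gcongr

include hA

/-- The similarity `(A - B)(1 + Γ_m X) = (1 + Γ_m X)(A - J_m X)`, domains included. -/
lemma IsSol.mapsTo_iff (hB : IsHS b B) (h : IsSol b ω k m B X)
    (hm : gapInv ω k m * hsNorm b B < 1 / 4) (x y : H) :
    MapsTo (subBounded A (Jm b m X)) x y ↔
      MapsTo (subBounded A B) (x + Gamm b ω k m X x) (y + Gamm b ω k m X y) := by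
  have hX := h.1
  have hG1 := h.norm_Gamm_lt hω hk hB hm
  have heq : ∀ x, X x = B x + B (Gamm b ω k m X x) - Gamm b ω k m X (Jm b m X x) := fun x => by
    conv_lhs => rw [h.eq hω hk hB]
    rfl
  have hGent := ent_Gamm hω hk hX m
  have hJent := ent_Jm hX m
  set G := Gamm b ω k m X
  set D := Jm b m X
  -- The shift `t` is taken so large that `‖G‖ + ‖X - D‖ ‖(A + t)⁻¹‖ < 1`. `K` below is `(A + t)⁻¹`,
  -- and replaces `A` so that all algebra is between bounded operators.
  obtain ⟨t, ht0, ht⟩ : ∃ t : ℝ, 0 < t ∧ ‖X - D‖ * t⁻¹ < 1 - ‖G‖ := by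
    refine ⟨‖X - D‖ / (1 - ‖G‖) + 1, by have := sub_pos.2 hG1; positivity, ?_⟩
    have h1 := sub_pos.2 hG1
    rw [mul_inv_lt_iff₀ (by positivity), mul_add, mul_div_cancel₀ _ h1.ne']
    linarith
  have hlt : ∀ i, (lam ω k i : ℂ) + t ≠ 0 := fun i => by
    rw [← Complex.ofReal_add]
    exact_mod_cast (add_pos (lam_pos hω i) ht0).ne'
  obtain ⟨K, hK⟩ := exists_diagonal b (d := fun n => ((lam ω k n : ℂ) + t)⁻¹)
    (summable_norm_inv_sq hω hk (C := t) fun n => by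
      rw [add_sub_cancel_left, Complex.norm_real, Real.norm_eq_abs, abs_of_pos ht0])
  have hAK : ∀ x z, MapsTo A x z ↔ x = K (z + (t : ℂ) • x) := fun x z => by
    rw [hA]
    constructor
    · intro hz
      refine ext_inner_basis (b := b) fun i => ?_
      rw [hK, inner_add_right, inner_smul_right, hz, ← add_mul, inv_mul_cancel_left₀ (hlt i)]
    · intro hz i
      have h1 := congrArg (inner ℂ (b i)) hz
      rw [hK, eq_inv_mul_iff_mul_eq₀ (hlt i), inner_add_right, inner_smul_right] at h1
      linear_combination -h1
  have hKnorm : ‖K‖ ≤ t⁻¹ := by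
    refine K.opNorm_le_bound (inv_pos.2 ht0).le fun x => norm_le_of_inner_le b
      (inv_pos.2 ht0).le fun i => ?_
    rw [hK, norm_mul, norm_inv, ← Complex.ofReal_add, Complex.norm_real, Real.norm_eq_abs,
      abs_of_pos (add_pos (lam_pos hω i) ht0)]
    gcongr
    linarith [lam_pos (k := k) hω i]
  have hKb : ∀ j, K (b j) = ((lam ω k j : ℂ) + t)⁻¹ • b j := fun j => by
    refine ext_inner_basis (b := b) fun i => ?_
    rw [hK, inner_smul_right, inner_basis]
    by_cases hij : i = j <;> simp [hij]
  -- The commutator equation `A G - G A = X - D` multiplied by `K` on both sides.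
  have hcomm : ∀ x, G (K x) = K (G x + (X - D) (K x)) := by
    have h1 : G ∘L K = K ∘L (G + (X - D) ∘L K) := by
      refine ext_ent (b := b) fun i j => ?_
      have e1 : ent b (G ∘L K) i j = ((lam ω k j : ℂ) + t)⁻¹ * ent b G i j := by
        unfold ent
        rw [ContinuousLinearMap.comp_apply, hKb, map_smul, inner_smul_right]
      have e2 : ent b (K ∘L (G + (X - D) ∘L K)) i j = ((lam ω k i : ℂ) + t)⁻¹ *
          (ent b G i j + ((lam ω k j : ℂ) + t)⁻¹ * ent b (X - D) i j) := by
        unfold ent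
        rw [ContinuousLinearMap.comp_apply, hK, add_apply, inner_add_right,
          ContinuousLinearMap.comp_apply, hKb, map_smul, inner_smul_right]
      rw [e1, e2, ent_sub, hGent, hJent]
      split_ifs with hij
      · simp
      · push Not at hij
        have hne : (lam ω k i : ℂ) - lam ω k j ≠ 0 := by
          rw [sub_ne_zero]
          exact fun hc => hij.1 (lam_injective hω hk (Complex.ofReal_injective hc))
        have := hlt i
        have := hlt j
        push_cast
        field_simp
        ring
    exact fun x => DFunLike.congr_fun h1 x
  have hforward : ∀ x y, MapsTo (subBounded A D) x y →
      MapsTo (subBounded A B) (x + G x) (y + G y) := by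
    intro x y hxy
    rw [mapsTo_subBounded, hAK] at hxy ⊢
    set w := y + D x + (t : ℂ) • x with hw
    have h1 : x + G x = K (w + (G w + (X - D) x)) := by
      rw [map_add K w]
      conv_rhs => enter [2, 2, 2]; rw [hxy]
      rw [← hcomm, ← hxy]
    conv_lhs => rw [h1]
    congr 1
    simp only [hw, sub_apply, map_add, map_smul, smul_add, heq x]
    abel
  refine ⟨hforward x y, fun hxy => ?_⟩
  -- The converse needs `x ∈ D(A)` from `(1 + G) x ∈ D(A)`. By `hcomm`, `(1 + G) K = K W` with `W =
  -- 1 + G + (X - D) K` invertible. So if `(1 + G) x = K v`, then `v = W w` gives `(1 + G) x = (1 +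
  -- G) K w`, and `x = K w` lies in `D(A)`.
  have hW : IsUnit (1 + (G + (X - D) ∘L K)) := by
    have := isUnit_one_sub_of_norm_lt_one (x := -(G + (X - D) ∘L K)) ?_
    · rwa [sub_neg_eq_add] at this
    · rw [norm_neg]
      have h1 := (norm_add_le G ((X - D) ∘L K)).trans (add_le_add_right
        ((ContinuousLinearMap.opNorm_comp_le _ _).trans
          (mul_le_mul_of_nonneg_left hKnorm (norm_nonneg _))) _)
      linarith
  have hU : IsUnit (1 + G) := by
    have := isUnit_one_sub_of_norm_lt_one (x := -G) (by rwa [norm_neg])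
    rwa [sub_neg_eq_add] at this
  have hUinj : ∀ u v : H, u + G u = v + G v → u = v := fun u v huv => by
    obtain ⟨V, hV⟩ := hU.exists_left_inv
    have h1 : ∀ z, V (z + G z) = z := fun z => DFunLike.congr_fun hV z
    rw [← h1 u, huv, h1]
  have hxy' := hxy
  rw [mapsTo_subBounded, hAK] at hxy'
  set v := y + G y + B (x + G x) + (t : ℂ) • (x + G x)
  obtain ⟨W, hWr⟩ := hW.exists_right_inv
  have h2 : W v + (G (W v) + (X - D) (K (W v))) = v := DFunLike.congr_fun hWr v
  have h3 : x = K (W v) := by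
    refine hUinj _ _ ?_
    rw [hxy', hcomm, ← map_add, h2]
  have h4 : MapsTo (subBounded A D) x (W v - (t : ℂ) • x - D x) := by
    rw [mapsTo_subBounded, hAK, sub_add_cancel, sub_add_cancel]
    exact h3
  have h5 := hUinj _ _ (hxy.unique (hforward _ _ h4))
  rw [h5]
  exact h4

omit [CompleteSpace H] hω hk in
lemma mapsTo_blockDiagonal_iff {x y : H} : MapsTo (subBounded A (Jm b m X)) x y ↔
    ∀ i, inner ℂ (b i) y + inner ℂ (b i) (Jm b m X x) = (lam ω k i : ℂ) * inner ℂ (b i) x := by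
  rw [mapsTo_subBounded, hA]
  simp only [inner_add_right]

omit hω hk in
lemma mapsTo_projLE (hX : IsHS b X) {x y : H} (h : MapsTo (subBounded A (Jm b m X)) x y) :
    MapsTo (subBounded A (Jm b m X)) (projLE b m x) (projLE b m y) := by
  have hc : Jm b m X (projLE b m x) = projLE b m (Jm b m X x) :=
    DFunLike.congr_fun ((Jm_comp_projLE hX m).trans (projLE_comp_Jm hX m).symm) x
  rw [mapsTo_blockDiagonal_iff hA] at h ⊢
  intro i
  rw [hc, inner_projLE, inner_projLE, inner_projLE]
  split_ifs
  · exact h i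
  · simp

omit hω hk in
lemma mapsTo_proj (hX : IsHS b X) {n : ℕ+} (hn : m < n) {x y : H}
    (h : MapsTo (subBounded A (Jm b m X)) x y) :
    MapsTo (subBounded A (Jm b m X)) (proj b n x) (proj b n y) := by
  have hc : Jm b m X (proj b n x) = proj b n (Jm b m X x) :=
    DFunLike.congr_fun ((Jm_comp_proj hX hn).trans (proj_comp_Jm hX hn).symm) x
  rw [mapsTo_blockDiagonal_iff hA] at h ⊢
  intro i
  rw [hc, inner_proj, inner_proj, inner_proj]
  split_ifs
  · exact h i
  · simp

omit [CompleteSpace H] hω hk hA in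
/-- The spectrum of `A - Q X Q` on `Im Q` when `Q X Q` and `J_m X` agree there. -/
lemma opSpectrum_restrictTo_cut {Q : H →L[ℂ] H} (hQ : ∀ x, Q (Q x) = Q x)
    (hQX : Jm b m X ∘L Q = Q ∘L X ∘L Q) :
    opSpectrum (restrictTo (subBounded A (Q ∘L X ∘L Q)) (LinearMap.range (Q : H →ₗ[ℂ] H)))
      = opSpectrum (restrictTo (subBounded A (Jm b m X)) (LinearMap.range (Q : H →ₗ[ℂ] H))) := by
  refine opSpectrum_congr fun x y => ?_
  rw [mapsTo_restrictTo, mapsTo_restrictTo, mapsTo_subBounded, mapsTo_subBounded, ← hQX,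
    ContinuousLinearMap.comp_apply, apply_eq_of_mem_range hQ x.2]

omit hω hk hA in
lemma sigmaLE_eq (hX : IsHS b X) : sigmaLE A b X m = opSpectrum
    (restrictTo (subBounded A (Jm b m X)) (LinearMap.range (projLE b m : H →ₗ[ℂ] H))) :=
  opSpectrum_restrictTo_cut (projLE_comp_projLE_apply m) (Jm_comp_projLE hX m)

omit hω hk hA in
lemma sigmaN_eq (hX : IsHS b X) {n : ℕ+} (hn : m < n) : sigmaN A b X n = opSpectrum
    (restrictTo (subBounded A (Jm b m X)) (LinearMap.range (proj b n : H →ₗ[ℂ] H))) :=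
  opSpectrum_restrictTo_cut (proj_comp_proj_apply n)
    ((Jm_comp_proj hX hn).trans (proj_comp_comp_proj_self X n).symm)

omit [CompleteSpace H] hω hk in
lemma exists_mapsTo_projLE (x : H) :
    ∃ y, MapsTo (subBounded A (Jm b m X)) (projLE b m x) y := by
  refine ⟨(∑ j ∈ Finset.Icc 1 m, (lam ω k j : ℂ) • proj b j x) - Jm b m X (projLE b m x), ?_⟩
  rw [mapsTo_subBounded, sub_add_cancel, hA]
  intro i
  rw [projLE_apply, inner_sum, inner_sum, Finset.mul_sum]
  refine Finset.sum_congr rfl fun j _ => ?_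
  rw [inner_smul_right, inner_proj]
  split_ifs with hij
  · rw [hij]
  · simp

omit hω hk in
lemma restrictTo_projLE_total (hX : IsHS b X)
    (x : LinearMap.range (projLE b m : H →ₗ[ℂ] H)) :
    ∃ y, MapsTo (restrictTo (subBounded A (Jm b m X))
      (LinearMap.range (projLE b m : H →ₗ[ℂ] H))) x y := by
  obtain ⟨y, hy⟩ := exists_mapsTo_projLE (m := m) hA (x : H)
  have h1 := mapsTo_projLE hA hX hy
  have hx := apply_eq_of_mem_range (projLE_comp_projLE_apply m) x.2
  rw [hx, hx] at h1
  exact ⟨⟨projLE b m y, ⟨y, rfl⟩⟩, mapsTo_restrictTo.2 h1⟩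

omit hω hk in
lemma mapsTo_basis (hX : IsHS b X) {n : ℕ+} (hn : m < n) :
    MapsTo (subBounded A (Jm b m X)) (b n) (((lam ω k n : ℂ) - ent b X n n) • b n) := by
  rw [mapsTo_blockDiagonal_iff hA]
  intro i
  rw [Jm_basis hX hn, inner_smul_right, inner_smul_right]
  by_cases hin : i = n
  · subst hin; ring
  · rw [inner_basis, if_neg hin]; simp

omit [CompleteSpace H] hω hk hA in
lemma range_proj (n : ℕ+) :
    LinearMap.range (proj b n : H →ₗ[ℂ] H) = Submodule.span ℂ {b n} := by
  refine le_antisymm ?_ ?_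
  · rintro _ ⟨x, rfl⟩
    exact Submodule.mem_span_singleton.2 ⟨_, (proj_apply b n x).symm⟩
  · rw [Submodule.span_singleton_le_iff_mem]
    exact ⟨b n, by simpa using proj_basis n n⟩

open Classical in
omit [CompleteSpace H] hω hk hA in
lemma range_projLE (m : ℕ+) :
    LinearMap.range (projLE b m : H →ₗ[ℂ] H) =
      Submodule.span ℂ ((Finset.Icc 1 m).image b : Finset H) := by
  refine le_antisymm ?_ ?_
  · rintro _ ⟨x, rfl⟩
    change projLE b m x ∈ _
    rw [projLE_apply]
    refine Submodule.sum_mem _ fun j hj => ?_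
    rw [proj_apply]
    exact Submodule.smul_mem _ _ (Submodule.subset_span (Finset.mem_image_of_mem _ hj))
  · rw [Submodule.span_le]
    intro v hv
    obtain ⟨j, hj, rfl⟩ := Finset.mem_image.1 hv
    exact ⟨b j, by simpa [(Finset.mem_Icc.1 hj).2] using projLE_basis m j⟩

omit [CompleteSpace H] hω hk hA in
lemma finiteDimensional_range_projLE (b : HilbertBasis ℕ+ ℂ H) (m : ℕ+) :
    FiniteDimensional ℂ (LinearMap.range (projLE b m : H →ₗ[ℂ] H)) := by
  classical
  rw [range_projLE]
  exact FiniteDimensional.span_finset ℂ _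

omit [CompleteSpace H] hω hk hA in
lemma finrank_range_projLE_le (b : HilbertBasis ℕ+ ℂ H) (m : ℕ+) :
    Module.finrank ℂ (LinearMap.range (projLE b m : H →ₗ[ℂ] H)) ≤ m := by
  classical
  rw [range_projLE]
  refine (finrank_span_finset_le_card _).trans (Finset.card_image_le.trans ?_)
  simp

omit hω hk in
lemma sigmaN_eq_singleton (hX : IsHS b X) {n : ℕ+} (hn : m < n) :
    sigmaN A b X n = {(lam ω k n : ℂ) - ent b X n n} := by
  have hfd : FiniteDimensional ℂ (LinearMap.range (proj b n : H →ₗ[ℂ] H)) := by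
    rw [range_proj]; infer_instance
  have hmaps : ∀ x : LinearMap.range (proj b n : H →ₗ[ℂ] H),
      MapsTo (subBounded A (Jm b m X)) (x : H) (((lam ω k n : ℂ) - ent b X n n) • (x : H)) := by
    rintro ⟨x, hx⟩
    rw [range_proj] at hx
    obtain ⟨c, rfl⟩ := Submodule.mem_span_singleton.1 hx
    have h1 := mapsTo_basis hA hX hn
    rw [mapsTo_blockDiagonal_iff hA] at h1 ⊢
    intro i
    have h2 := h1 i
    simp only [map_smul, inner_smul_right] at h2 ⊢
    linear_combination c * h2
  have hbn : b n ≠ 0 := b.orthonormal.ne_zero n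
  rw [sigmaN_eq hX hn, opSpectrum_eq_setOf_eigenvalue fun x =>
    ⟨((lam ω k n : ℂ) - ent b X n n) • x, mapsTo_restrictTo.2 (hmaps x)⟩]
  ext μ
  rw [Set.mem_ofPred_eq, Set.mem_singleton_iff]
  constructor
  · rintro ⟨v, hv, h⟩
    rw [mapsTo_restrictTo] at h
    have h1 := h.unique (hmaps v)
    exact smul_left_injective ℂ (fun hc => hv (Subtype.ext hc)) h1
  · rintro rfl
    have hmem : b n ∈ LinearMap.range (proj b n : H →ₗ[ℂ] H) := by
      rw [range_proj]; exact Submodule.mem_span_singleton_self _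
    exact ⟨⟨b n, hmem⟩, fun hc => hbn (congrArg Subtype.val hc),
      mapsTo_restrictTo.2 (hmaps ⟨b n, hmem⟩)⟩

/-- The resolvent is assembled from that of the finite block and the diagonal operator with entries
`(λ_n - x_nn - μ)⁻¹` for `n > m` and zero for `n ≤ m`, bounded by `summable_norm_inv_sq`. -/
lemma opSpectrum_blockDiagonal_subset (hX : IsHS b X) {μ : ℂ} (hμ : μ ∉ sigmaLE A b X m)
    (hμn : ∀ n, m < n → μ ≠ (lam ω k n : ℂ) - ent b X n n) :
    μ ∉ opSpectrum (subBounded A (Jm b m X)) := by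
  rw [sigmaLE_eq hX] at hμ
  obtain ⟨S, hS⟩ := not_not.1 hμ
  rw [isResolventAt_iff] at hS
  let V := LinearMap.range (projLE b m : H →ₗ[ℂ] H)
  let a : ℕ+ → ℂ := fun n => (lam ω k n : ℂ) - ent b X n n - μ
  have ha : ∀ n, m < n → a n ≠ 0 := fun n hn => sub_ne_zero.2 (hμn n hn).symm
  have hs : Summable fun n => ‖(a n)⁻¹‖ ^ 2 :=
    summable_norm_inv_sq hω hk (C := hsNorm b X + ‖μ‖) fun n => by
      have : a n - lam ω k n = -(ent b X n n + μ) := by simp only [a]; ring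
      rw [this, norm_neg]
      exact (norm_add_le _ _).trans (add_le_add_left (norm_ent_le_hsNorm hX n n) _)
  obtain ⟨K, hK⟩ := exists_diagonal b (d := fun n => if n ≤ m then 0 else (a n)⁻¹)
    (hs.of_nonneg_of_le (fun _ => by positivity) fun n => by
      split_ifs
      · rw [norm_zero, zero_pow two_ne_zero]; positivity
      · rfl)
  let P : H →L[ℂ] V := (projLE b m).codRestrict V fun x => ⟨x, rfl⟩
  have hP : ∀ x, (P x : H) = projLE b m x := fun x => rfl
  have hSP : ∀ y : V, projLE b m (S y : H) = S y := fun y =>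
    apply_eq_of_mem_range (projLE_comp_projLE_apply m) (S y).2
  refine not_not.2 ⟨V.subtypeL ∘L S ∘L P + K, isResolventAt_iff.2 ⟨fun y => ?_, fun x y hxy => ?_⟩⟩
  · change MapsTo _ ((S (P y) : H) + K y) (y + μ • ((S (P y) : H) + K y))
    have h1 := mapsTo_restrictTo.1 (hS.1 (P y))
    rw [mapsTo_blockDiagonal_iff hA] at h1 ⊢
    intro i
    have h2 := h1 i
    change inner ℂ (b i) (projLE b m y + μ • (S (P y) : H)) + _ = _ at h2
    simp only [inner_add_right, inner_smul_right, map_add, hK, inner_projLE] at h2 ⊢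
    by_cases hi : i ≤ m
    · have h3 : inner ℂ (b i) (Jm b m X (K y)) = 0 := by
        have h4 := inner_projLE (b := b) m i (Jm b m X (K y))
        rw [if_pos hi] at h4
        have h5 := DFunLike.congr_fun
          ((projLE_comp_Jm hX m).trans (Jm_comp_projLE hX m).symm) (K y)
        simp only [ContinuousLinearMap.comp_apply] at h5
        have h6 : projLE b m (K y) = 0 := by
          refine ext_inner_basis (b := b) fun j => ?_
          rw [inner_projLE, hK, inner_zero_right]
          split_ifs <;> simp
        rw [← h4, h5, h6, map_zero, inner_zero_right]
      simp only [if_pos hi, zero_mul, add_zero, h3] at h2 ⊢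
      exact h2
    · have h3 : inner ℂ (b i) (S (P y) : H) = 0 := by
        rw [← hSP, inner_projLE, if_neg hi]
      have hi' := not_le.1 hi
      simp only [if_neg hi, inner_Jm hX hi', h3, hK, mul_zero, zero_add]
      have := ha i hi'
      have h4 : (lam ω k i : ℂ) = a i + ent b X i i + μ := by simp only [a]; ring
      rw [h4]
      field_simp
      ring
  · change (S (P (y - μ • x)) : H) + K (y - μ • x) = x
    have h1 := hS.2 (P x) (P y) (mapsTo_restrictTo.2 (mapsTo_projLE hA hX hxy))
    rw [map_sub, map_smul, h1, hP]
    refine ext_inner_basis (b := b) fun i => ?_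
    rw [inner_add_right, inner_projLE, hK]
    by_cases hi : i ≤ m
    · simp [hi]
    · rw [mapsTo_blockDiagonal_iff hA] at hxy
      have h2 := hxy i
      have hi' := not_le.1 hi
      rw [inner_Jm hX hi'] at h2
      rw [if_neg hi, if_neg hi, zero_add, inv_mul_eq_iff_eq_mul₀ (ha i hi'), inner_sub_right,
        inner_smul_right]
      simp only [a]
      linear_combination h2

lemma opSpectrum_blockDiagonal (hX : IsHS b X) :
    opSpectrum (subBounded A (Jm b m X)) =
      sigmaLE A b X m ∪ ⋃ n : ℕ+, ⋃ _ : m + 1 ≤ n, sigmaN A b X n := by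
  refine Set.Subset.antisymm ?_ (Set.union_subset ?_ (Set.iUnion₂_subset fun n hn => ?_))
  · intro μ hμ
    by_contra hc
    rw [Set.mem_union, not_or] at hc
    refine opSpectrum_blockDiagonal_subset hω hk hA hX hc.1 (fun n hn he => hc.2 ?_) hμ
    refine Set.mem_iUnion₂.2 ⟨n, PNat.add_one_le_iff.2 hn, ?_⟩
    rw [sigmaN_eq_singleton hA hX hn]
    exact he
  · rw [sigmaLE_eq hX]
    exact opSpectrum_restrictTo_subset (projLE_comp_projLE_apply m) fun x y h =>
      mapsTo_projLE hA hX h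
  · rw [sigmaN_eq hX (PNat.add_one_le_iff.1 hn)]
    exact opSpectrum_restrictTo_subset (proj_comp_proj_apply n) fun x y h =>
      mapsTo_proj hA hX (PNat.add_one_le_iff.1 hn) h

end Spectrum

/-! ### Separation of the spectral pieces, simplicity and asymptotics. -/

section Estimates

variable {H : Type*} [NormedAddCommGroup H] [InnerProductSpace ℂ H] [CompleteSpace H]
variable {b : HilbertBasis ℕ+ ℂ H} {ω : ℝ} {k : ℕ} (hω : 0 < ω) (hk : 1 ≤ k)
variable {m : ℕ+} {A : H →ₗ.[ℂ] H} {B X : H →L[ℂ] H}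
variable (hA : ∀ x y, MapsTo A x y ↔
  ∀ i, inner ℂ (b i) y = (lam ω k i : ℂ) * inner ℂ (b i) x)

omit [CompleteSpace H] in
lemma norm_sub_coord_smul_le (y : H) (n : ℕ+) : ‖y - inner ℂ (b n) y • b n‖ ≤ ‖y‖ := by
  have := norm_le_of_inner_le b (x := y - inner ℂ (b n) y • b n) (y := y) zero_le_one fun i => by
    rw [inner_sub_right, inner_smul_right, inner_basis, one_mul]
    by_cases h : i = n
    · subst h; simp
    · simp [h]
  rwa [one_mul] at this

lemma norm_ent_le_hsNorm_Jm (hX : IsHS b X) {n : ℕ+} :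
    ‖ent b X n n‖ ≤ hsNorm b (Jm b m X) := by
  have := norm_ent_le_hsNorm (hX.jm m).1 n n
  rwa [ent_Jm hX, if_pos (Or.inl rfl)] at this

include hA in
-- An eigenvalue of a perturbed diagonal matrix lies within the norm of the perturbation of some
-- diagonal entry: otherwise an eigenvector `v` would satisfy `δ‖v‖ ≤ ‖J_m X v‖` with `δ` larger
-- than the norm of `J_m X`.
lemma exists_dist_lam_le_of_mem_sigmaLE (hX : IsHS b X) {μ : ℂ} (hμ : μ ∈ sigmaLE A b X m) :
    ∃ i ≤ m, ‖(lam ω k i : ℂ) - μ‖ ≤ hsNorm b (Jm b m X) := by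
  have := finiteDimensional_range_projLE b m
  rw [sigmaLE_eq hX, opSpectrum_eq_setOf_eigenvalue (restrictTo_projLE_total hA hX)] at hμ
  obtain ⟨v, hv, h⟩ := hμ
  rw [mapsTo_restrictTo, mapsTo_blockDiagonal_iff hA] at h
  have hv0 : 0 < ‖(v : H)‖ := norm_pos_iff.2 fun hc => hv (Subtype.ext hc)
  by_contra! hc
  obtain ⟨i₀, hi₀, hmin⟩ := Finset.exists_min_image (Finset.Icc 1 m)
    (fun i => ‖(lam ω k i : ℂ) - μ‖) ⟨1, Finset.mem_Icc.2 ⟨le_rfl, one_le⟩⟩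
  set δ := ‖(lam ω k i₀ : ℂ) - μ‖
  have hδ : hsNorm b (Jm b m X) < δ := hc i₀ (Finset.mem_Icc.1 hi₀).2
  have hδ0 : 0 < δ := (hsNorm_nonneg _ _).trans_lt hδ
  have h1 : ‖(v : H)‖ ≤ δ⁻¹ * ‖Jm b m X v‖ := by
    refine norm_le_of_inner_le b (inv_pos.2 hδ0).le fun i => ?_
    rw [← div_eq_inv_mul, le_div_iff₀ hδ0]
    by_cases hi : i ≤ m
    · have h2 := h i
      change inner ℂ (b i) (μ • (v : H)) + _ = _ at h2
      rw [inner_smul_right] at h2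
      have h3 : inner ℂ (b i) (Jm b m X v) = ((lam ω k i : ℂ) - μ) * inner ℂ (b i) (v : H) := by
        linear_combination h2
      rw [h3, norm_mul, mul_comm]
      exact mul_le_mul_of_nonneg_right (hmin i (Finset.mem_Icc.2 ⟨one_le, hi⟩)) (norm_nonneg _)
    · rw [← apply_eq_of_mem_range (projLE_comp_projLE_apply m) v.2, inner_projLE, if_neg hi,
        norm_zero, zero_mul]
      exact norm_nonneg _
  rw [← div_eq_inv_mul, le_div_iff₀ hδ0] at h1
  have h2 := (Jm b m X).le_opNorm v
  have h3 := norm_le_hsNorm (hX.jm m).1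
  nlinarith

include hA in
-- A root vector is killed by the projection onto every block whose spectrum misses the eigenvalue,
-- which leaves only the line of `b_n`.
lemma isSimpleEigenvalue_blockDiagonal (hX : IsHS b X) {n : ℕ+} (hn : m < n)
    (hLE : (lam ω k n : ℂ) - ent b X n n ∉ sigmaLE A b X m)
    (hN : ∀ j, m < j → j ≠ n → (lam ω k n : ℂ) - ent b X n n ∉ sigmaN A b X j) :
    IsSimpleEigenvalue (subBounded A (Jm b m X)) ((lam ω k n : ℂ) - ent b X n n) := by
  refine ⟨b n, b.orthonormal.ne_zero n, fun x => ⟨?_, fun hx => ?_⟩⟩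
  · rintro ⟨r, hr⟩
    rw [sigmaLE_eq hX] at hLE
    have h1 := eq_zero_of_isRootVector (fun x y h => mapsTo_projLE hA hX h) hLE r x hr
    refine Submodule.mem_span_singleton.2 ⟨inner ℂ (b n) x, ?_⟩
    refine ext_inner_basis (b := b) fun i => ?_
    rw [inner_smul_right, inner_basis]
    by_cases hin : i = n
    · subst hin; simp
    rw [if_neg hin, mul_zero]
    by_cases hi : i ≤ m
    · have h2 := inner_projLE (b := b) m i x
      rw [h1, inner_zero_right, if_pos hi] at h2
      exact h2
    · have hi' := not_le.1 hi
      have h3 := hN i hi' hin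
      rw [sigmaN_eq hX hi'] at h3
      have h4 := eq_zero_of_isRootVector (fun x y h => mapsTo_proj hA hX hi' h) h3 r x hr
      have h2 := inner_proj (b := b) i i x
      rw [h4, inner_zero_right, if_pos rfl] at h2
      exact h2
  · obtain ⟨c, rfl⟩ := Submodule.mem_span_singleton.1 hx
    refine ⟨1, isRootVector_succ.2 ⟨((lam ω k n : ℂ) - ent b X n n) • c • b n, ?_, ?_⟩⟩
    · have h1 := mapsTo_basis hA hX hn
      rw [mapsTo_blockDiagonal_iff hA] at h1 ⊢
      intro i
      have h2 := h1 i
      simp only [map_smul, inner_smul_right] at h2 ⊢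
      linear_combination c * h2
    · exact sub_self _

include hω hk

/-- The gaps of the unperturbed spectrum dominate twice the size of the block diagonal part. -/
lemma IsSol.two_mul_hsNorm_Jm_lt (hB : IsHS b B) (h : IsSol b ω k m B X)
    (hm : gapInv ω k m * hsNorm b B < 1 / 4) {n j : ℕ+} (hnj : n ≠ j) (hn : m < n) :
    2 * hsNorm b (Jm b m X) < ‖(lam ω k n : ℂ) - lam ω k j‖ := by
  have h1 := h.hsNorm_Jm_le hω hk hB
  have hg := gapInv_pos (k := k) hω m
  have n1 := hsNorm_nonneg b B
  have h2 : (gapInv ω k m)⁻¹ ≤ ‖(lam ω k n : ℂ) - lam ω k j‖ := by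
    rw [← Complex.ofReal_sub, Complex.norm_real, Real.norm_eq_abs, gapInv, inv_inv]
    exact le_abs_lam_sub' hω hk hnj fun hc => absurd hc.1 (not_le.2 hn)
  refine lt_of_lt_of_le ?_ h2
  rw [← one_div, lt_div_iff₀ hg]
  have h3 := mul_le_mul_of_nonneg_right h1 hg.le
  have h4 : 0 ≤ gapInv ω k m * hsNorm b B := by positivity
  -- With `t = gapInv * ‖B‖₂`, the claim reduces to `2t(1 + 4t) < 1`, with equality precisely at `t
  -- = 1/4`.
  nlinarith

lemma IsSol.disjoint_sigmaN (hB : IsHS b B) (h : IsSol b ω k m B X)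
    (hm : gapInv ω k m * hsNorm b B < 1 / 4) {n j : ℕ+} (hnj : n ≠ j) (hn : m < n) :
    (lam ω k n : ℂ) - ent b X n n ≠ (lam ω k j : ℂ) - ent b X j j := by
  intro hc
  have h1 := h.two_mul_hsNorm_Jm_lt hω hk hB hm hnj hn
  have h2 : (lam ω k n : ℂ) - lam ω k j = ent b X n n - ent b X j j := by linear_combination hc
  rw [h2] at h1
  have h3 := norm_sub_le (ent b X n n) (ent b X j j)
  linarith [norm_ent_le_hsNorm_Jm (m := m) h.1 (n := n), norm_ent_le_hsNorm_Jm (m := m) h.1 (n := j)]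

include hA in
lemma IsSol.notMem_sigmaLE (hB : IsHS b B) (h : IsSol b ω k m B X)
    (hm : gapInv ω k m * hsNorm b B < 1 / 4) {n : ℕ+} (hn : m < n) :
    (lam ω k n : ℂ) - ent b X n n ∉ sigmaLE A b X m := by
  intro hc
  obtain ⟨i, hi, h0⟩ := exists_dist_lam_le_of_mem_sigmaLE hA h.1 hc
  have h1 := h.two_mul_hsNorm_Jm_lt hω hk hB hm (hi.trans_lt hn).ne' hn
  have h2 : (lam ω k n : ℂ) - lam ω k i
      = ent b X n n - ((lam ω k i : ℂ) - ((lam ω k n : ℂ) - ent b X n n)) := by ring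
  rw [h2] at h1
  have h3 := norm_sub_le (ent b X n n) ((lam ω k i : ℂ) - ((lam ω k n : ℂ) - ent b X n n))
  linarith [norm_ent_le_hsNorm_Jm (m := m) h.1 (n := n)]

lemma IsSol.ent_self (hB : IsHS b B) (h : IsSol b ω k m B X) (n : ℕ+) :
    ent b X n n = ent b B n n + ent b (B ∘L Gamm b ω k m X) n n := by
  have h1 := ent_Jm h.1 m n n
  rw [h.Jm_eq hω hk hB, ent_Jm (hB.add (hB.comp (h.1.gamm hω hk m).1).1),
    if_pos (Or.inl rfl), if_pos (Or.inl rfl), ent_add] at h1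
  exact h1.symm

/-- The size of the second-order term in the eigenvalue asymptotics. -/
lemma IsSol.norm_ent_comp_Gamm_le (hB : IsHS b B) (h : IsSol b ω k m B X)
    (hm : gapInv ω k m * hsNorm b B < 1 / 4) {n : ℕ+} (hn : m < n) {g : ℝ} (hg0 : 0 < g)
    (hg : ∀ j, j ≠ n → g⁻¹ ≤ |lam ω k j - lam ω k n|) (hgB : 6 * hsNorm b B * g ≤ 1) :
    ‖ent b (B ∘L Gamm b ω k m X) n n‖ ≤ 2 * g *
      hsNorm b (proj b n ∘L B - proj b n ∘L B ∘L proj b n) *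
      hsNorm b (B ∘L proj b n - proj b n ∘L B ∘L proj b n) := by
  have hX := h.1
  have hG := hX.gamm hω hk m
  have n1 := hsNorm_nonneg b B
  set G := Gamm b ω k m X
  have hGent : ∀ i j, ent b G i j = _ := ent_Gamm hω hk hX m
  have hGn : proj b n (G (b n)) = 0 := by
    rw [proj_apply, show inner ℂ (b n) (G (b n)) = ent b G n n from rfl, hGent,
      if_pos (Or.inl rfl), zero_smul]
  -- The off-diagonal part of the `n`-th column of `X`; only this part enters `G b_n`.
  set xo := X (b n) - ent b X n n • b n
  have hxo : ∀ i, inner ℂ (b i) xo = if i = n then 0 else ent b X i n := fun i => by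
    simp only [xo]
    rw [inner_sub_right, inner_smul_right, inner_basis]
    by_cases hi : i = n
    · subst hi; simp [ent]
    · simp [hi, ent]
  have hGb : ‖G (b n)‖ ≤ g * ‖xo‖ := by
    refine norm_le_of_inner_le b hg0.le fun i => ?_
    rw [hxo, show inner ℂ (b i) (G (b n)) = ent b G i n from rfl, hGent]
    by_cases hi : i = n
    · simp [hi]
    · have h1 : ¬ (i = n ∨ i ≤ m ∧ n ≤ m) := fun hc =>
        hc.elim hi fun hc => absurd hc.2 (not_le.2 hn)
      rw [if_neg h1, if_neg hi, norm_mul, Complex.norm_real, Real.norm_eq_abs, abs_inv]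
      refine mul_le_mul_of_nonneg_right ?_ (norm_nonneg _)
      exact inv_le_of_inv_le₀ hg0 (hg i hi)
  have hBHS : IsHS b (B ∘L proj b n) := by
    refine (hB.of_ent_le zero_le_one fun i j => ?_).1
    rw [ent_comp_proj, one_mul]
    split_ifs <;> simp
  have hPB := (hB.comp_left (proj b n)).1
  have hPBP := (hBHS.comp_left (proj b n)).1
  set Bc := hsNorm b (B ∘L proj b n - proj b n ∘L B ∘L proj b n)
  set Br := hsNorm b (proj b n ∘L B - proj b n ∘L B ∘L proj b n)
  have hBc : ‖B (b n) - ent b B n n • b n‖ ≤ Bc := by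
    have h1 := norm_apply_basis_le_hsNorm (hBHS.sub hPBP) n
    have h2 : (B ∘L proj b n - proj b n ∘L B ∘L proj b n) (b n)
        = B (b n) - ent b B n n • b n := by
      rw [sub_apply, ContinuousLinearMap.comp_apply, ContinuousLinearMap.comp_apply,
        ContinuousLinearMap.comp_apply, proj_basis, if_pos rfl, proj_apply b n (B (b n))]
      rfl
    rwa [h2] at h1
  have hXnn : ‖ent b X n n‖ ≤ 2 * hsNorm b B := by
    have h1 := h.hsNorm_Jm_le hω hk hB
    have h2 := norm_ent_le_hsNorm_Jm (m := m) hX (n := n)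
    nlinarith
  -- The column of `IsSol.eq` gives `‖xo‖ ≤ Bc + (1 + 2)‖B‖₂ g ‖xo‖`. The condition `6‖B‖₂ g ≤ 1`
  -- makes the last term at most `‖xo‖/2`; hence the constant 6 in the threshold and the factor 2 in
  -- the bound.
  have hxo_le : ‖xo‖ ≤ 2 * Bc := by
    have h1 : xo = (B (b n) - ent b B n n • b n)
        + (B (G (b n)) - inner ℂ (b n) (B (G (b n))) • b n) - ent b X n n • G (b n) := by
      have h2 := DFunLike.congr_fun (h.eq hω hk hB) (b n)
      have h3 := h.ent_self hω hk hB n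
      change X (b n) = B (b n) + B (G (b n)) - G (Jm b m X (b n)) at h2
      change _ = _ + inner ℂ (b n) (B (G (b n))) at h3
      rw [Jm_basis hX hn, map_smul] at h2
      simp only [xo]
      rw [h2, h3]
      module
    have h4 : ‖B (G (b n)) - inner ℂ (b n) (B (G (b n))) • b n‖ ≤ hsNorm b B * (g * ‖xo‖) :=
      (norm_sub_coord_smul_le _ _).trans ((B.le_opNorm _).trans
        (mul_le_mul (norm_le_hsNorm hB) hGb (norm_nonneg _) n1))
    have h5 : ‖ent b X n n • G (b n)‖ ≤ 2 * hsNorm b B * (g * ‖xo‖) := by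
      rw [norm_smul]
      exact mul_le_mul hXnn hGb (norm_nonneg _) (by positivity)
    have h6 := (norm_sub_le ((B (b n) - ent b B n n • b n)
        + (B (G (b n)) - inner ℂ (b n) (B (G (b n))) • b n)) (ent b X n n • G (b n))).trans
        (add_le_add_left (norm_add_le _ _) _)
    rw [← h1] at h6
    nlinarith [norm_nonneg xo, mul_le_mul_of_nonneg_right hgB (norm_nonneg xo)]
  -- Since `P_n G b_n = 0`, the row of `B` may be stripped of its diagonal entry.
  have hfin : ent b (B ∘L G) n n
      = inner ℂ (b n) ((proj b n ∘L B - proj b n ∘L B ∘L proj b n) (G (b n))) := by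
    rw [sub_apply, ContinuousLinearMap.comp_apply, ContinuousLinearMap.comp_apply,
      ContinuousLinearMap.comp_apply, hGn, map_zero, map_zero, sub_zero, inner_proj, if_pos rfl]
    rfl
  rw [hfin]
  refine (norm_inner_le_norm _ _).trans ?_
  rw [b.orthonormal.1, one_mul]
  refine ((proj b n ∘L B - proj b n ∘L B ∘L proj b n).le_opNorm _).trans ?_
  calc _ ≤ Br * (g * (2 * Bc)) := by
        refine mul_le_mul (norm_le_hsNorm (hPB.sub hPBP)) (hGb.trans ?_) (norm_nonneg _)
          (hsNorm_nonneg _ _)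
        gcongr
    _ = 2 * g * Br * Bc := by ring

end Estimates

/-! ### Rewriting of the constants, and assembly of the theorem. -/

lemma gapInv_mul_eq (ω : ℝ) (k : ℕ) (m : ℕ+) (x : ℝ) :
    gapInv ω k m * x =
      ω ^ (2 * k) * x / (Real.pi ^ (2 * k) * (2 * (m : ℝ) + 1) * (m : ℝ) ^ (2 * k - 2)) := by
  unfold gapInv
  rw [mul_inv, inv_div, div_mul_eq_mul_div, mul_assoc (Real.pi ^ (2 * k)),
    div_mul_eq_div_div, div_eq_mul_inv _ ((2 * (m : ℝ) + 1) * _)]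
  ring

/-- The threshold condition in multiplicative form. -/
lemma le_pow_of_rpow_le {c x : ℝ} (hc : 0 ≤ c) {k : ℕ} (hk : 1 ≤ k)
    (h : c ^ (1 / (2 * (k : ℝ) - 1)) ≤ x) : c ≤ x ^ (2 * k - 1) := by
  have h1 : (2 * (k : ℝ) - 1) = ((2 * k - 1 : ℕ) : ℝ) := by
    rw [Nat.cast_sub (by omega)]; push_cast; ring
  rw [h1, one_div] at h
  have h2 := pow_le_pow_left₀ (Real.rpow_nonneg hc _) h (2 * k - 1)
  rwa [Real.rpow_inv_natCast_pow hc (by omega)] at h2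

end DirSim

end

theorem mainTheorem10 {H : Type*} [NormedAddCommGroup H] [InnerProductSpace ℂ H] [CompleteSpace H]
    (ω : ℝ) (hω : 0 < ω) (k : ℕ) (hk : 1 < k)
    (A : H →ₗ.[ℂ] H) (e : ℕ+ → H) (hA : DirSim.IsDirichletModel A e ω k)
    (B : H →L[ℂ] H) (hB : DirSim.IsHS e B) (m : ℕ+)
    (hm : ω ^ (2 * k) * DirSim.hsNorm e B /
      (Real.pi ^ (2 * k) * (2 * (m : ℝ) + 1) * (m : ℝ) ^ (2 * k - 2)) < 1 / 4) :
    ∃ X : H →L[ℂ] H,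
      -- the solution of the nonlinear equation in the ball, and its uniqueness
      DirSim.IsSol e ω k m B X ∧ (∀ Y : H →L[ℂ] H, DirSim.IsSol e ω k m B Y → Y = X) ∧
      -- the form of the spectrum
      DirSim.opSpectrum (DirSim.subBounded A B) =
        DirSim.sigmaLE A e X m ∪ ⋃ n : ℕ+, ⋃ _ : m + 1 ≤ n, DirSim.sigmaN A e X n ∧
      (∀ n : ℕ+, m + 1 ≤ n → Disjoint (DirSim.sigmaLE A e X m) (DirSim.sigmaN A e X n)) ∧
      (∀ n j : ℕ+, m + 1 ≤ n → m + 1 ≤ j → n ≠ j →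
        Disjoint (DirSim.sigmaN A e X n) (DirSim.sigmaN A e X j)) ∧
      (DirSim.sigmaLE A e X m).Finite ∧ (DirSim.sigmaLE A e X m).ncard ≤ (m : ℕ) ∧
      -- the simple eigenvalues and their asymptotics
      ∃ lamT η : ℕ+ → ℂ,
        (∀ n : ℕ+, m + 1 ≤ n → DirSim.sigmaN A e X n = {lamT n} ∧
          DirSim.IsSimpleEigenvalue (DirSim.subBounded A B) (lamT n)) ∧
        ∀ n : ℕ+,
          max ((m : ℝ) + 1)
            ((6 * DirSim.hsNorm e B * ω ^ (2 * k) / Real.pi ^ (2 * k)) ^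
              (1 / (2 * (k : ℝ) - 1))) ≤ (n : ℝ) →
          lamT n = ((Real.pi ^ (2 * k) * (n : ℝ) ^ (2 * k) / ω ^ (2 * k) : ℝ) : ℂ)
            - inner ℂ (e n) (B (e n)) + η n ∧
          ‖η n‖ ≤ 2 * ω ^ (2 * k) / (Real.pi ^ (2 * k) * (n : ℝ) ^ (2 * k - 1)) *
            DirSim.hsNorm e (DirSim.proj e n ∘L B - DirSim.proj e n ∘L B ∘L DirSim.proj e n) *
            DirSim.hsNorm e (B ∘L DirSim.proj e n - DirSim.proj e n ∘L B ∘L DirSim.proj e n) := by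

  have hk1 : 1 ≤ k := hk.le
  obtain ⟨b, rfl, hAb⟩ := hA.exists_hilbertBasis hω hk1
  have hA' : ∀ x y, DirSim.MapsTo A x y ↔
    ∀ i, inner ℂ (b i) y = (DirSim.lam ω k i : ℂ) * inner ℂ (b i) x := hAb
  have hm' : DirSim.gapInv ω k m * DirSim.hsNorm b B < 1 / 4 := by
    rwa [DirSim.gapInv_mul_eq]
  obtain ⟨X, hX, huniq⟩ := DirSim.exists_unique_isSol hω hk1 hB hm'
  have hlt : ∀ {n : ℕ+}, m + 1 ≤ n → m < n := fun h => PNat.add_one_le_iff.1 h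
  have hsing : ∀ {n : ℕ+}, m < n → DirSim.sigmaN A b X n = _ := fun hn =>
    DirSim.sigmaN_eq_singleton hA' hX.1 hn
  obtain ⟨V, hV⟩ : ∃ V : H →L[ℂ] H, (∀ x, (1 + DirSim.Gamm b ω k m X) (V x) = x) ∧
      ∀ x, V ((1 + DirSim.Gamm b ω k m X) x) = x := by
    have hu := isUnit_one_sub_of_norm_lt_one (x := -DirSim.Gamm b ω k m X)
      (by rw [norm_neg]; exact hX.norm_Gamm_lt hω hk1 hB hm')
    rw [sub_neg_eq_add] at hu
    obtain ⟨V, h1, h2⟩ := isUnit_iff_exists.1 hu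
    exact ⟨V, fun x => DFunLike.congr_fun h1 x, fun x => DFunLike.congr_fun h2 x⟩
  have hsim : ∀ x y, DirSim.MapsTo (DirSim.subBounded A (DirSim.Jm b m X)) x y ↔
      DirSim.MapsTo (DirSim.subBounded A B) ((1 + DirSim.Gamm b ω k m X) x)
        ((1 + DirSim.Gamm b ω k m X) y) := hX.mapsTo_iff hω hk1 hA' hB hm'
  have hfd := DirSim.finiteDimensional_range_projLE b m
  have hfin := DirSim.opSpectrum_finite (DirSim.restrictTo_projLE_total (m := m) hA' hX.1)
  rw [← DirSim.sigmaLE_eq hX.1] at hfin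
  refine ⟨X, hX, huniq, ?_, fun n hn => ?_, fun n j hn hj hnj => ?_, hfin.1,
    hfin.2.trans (DirSim.finrank_range_projLE_le b m),
    -- By `IsSol.ent_self` the diagonal entry of `X` is that of `B` plus that of `B Γ_m X`, which
    -- dictates the choice of `η`.
    fun n => (DirSim.lam ω k n : ℂ) - DirSim.ent b X n n,
    fun n => -DirSim.ent b (B ∘L DirSim.Gamm b ω k m X) n n, fun n hn => ⟨hsing (hlt hn), ?_⟩,
    fun n hn => ⟨?_, ?_⟩⟩
  · rw [DirSim.opSpectrum_eq_of_similar hV.1 hV.2 hsim]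
    exact DirSim.opSpectrum_blockDiagonal hω hk1 hA' hX.1
  · rw [hsing (hlt hn), Set.disjoint_singleton_right]
    exact hX.notMem_sigmaLE hω hk1 hA' hB hm' (hlt hn)
  · rw [hsing (hlt hn), hsing (hlt hj), Set.disjoint_singleton]
    exact hX.disjoint_sigmaN hω hk1 hB hm' hnj (hlt hn)
  · refine DirSim.IsSimpleEigenvalue.of_similar hV.1 hV.2 hsim
      (DirSim.isSimpleEigenvalue_blockDiagonal hA' hX.1 (hlt hn)
        (hX.notMem_sigmaLE hω hk1 hA' hB hm' (hlt hn)) fun j hj hjn => ?_)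
    rw [hsing hj, Set.mem_singleton_iff]
    exact hX.disjoint_sigmaN hω hk1 hB hm' hjn.symm (hlt hn)
  · change (DirSim.lam ω k n : ℂ) - DirSim.ent b X n n = (DirSim.lam ω k n : ℂ)
      - DirSim.ent b B n n + -DirSim.ent b (B ∘L DirSim.Gamm b ω k m X) n n
    rw [hX.ent_self hω hk1 hB n]
    ring
  · have hmn : m < n := by
      have h1 : (m : ℝ) + 1 ≤ n := (le_max_left _ _).trans hn
      have h2 : (m : ℕ) + 1 ≤ n := by exact_mod_cast h1
      exact h2
    have hb := DirSim.hsNorm_nonneg b B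
    have hπ := Real.pi_pos
    have hn0 : (0 : ℝ) < n := by exact_mod_cast n.pos
    have hpow := DirSim.le_pow_of_rpow_le (by positivity) hk1 ((le_max_right _ _).trans hn)
    rw [div_le_iff₀ (by positivity)] at hpow
    rw [norm_neg]
    -- `g` is the reciprocal of the gap bound at `n` from `le_abs_lam_sub`; the threshold on `n` is
    -- equivalent to `6‖B‖₂ g ≤ 1`.
    have hest := hX.norm_ent_comp_Gamm_le hω hk1 hB hm' hmn
      (g := ω ^ (2 * k) / (Real.pi ^ (2 * k) * (n : ℝ) ^ (2 * k - 1))) (by positivity)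
      (fun j hj => by
        rw [inv_div, ← div_mul_eq_mul_div]
        exact DirSim.le_abs_lam_sub hω hk1 hj.symm)
      (by
        rw [← mul_div_assoc, div_le_one (by positivity)]
        linarith)
    rwa [← mul_div_assoc] at hest
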